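/- Let $n\in\mathbb N$ and $a\le b$ be real. Put $\mathcal J=\begin{pmatrix}0&I\\-I&0\end{pmatrix}\in\mathbb R^{2n\times 2n}$ and $E=\begin{pmatrix}0\\I\end{pmatrix}\in\mathbb R^{2n\times n}$. A matrix $S\in\mathbb R^{2n\times 2n}$ is symplectic if $S^T\mathcal JS=\mathcal J$. A continuous Lagrangian path on $[a,b]$ is a continuous $Y=\begin{pmatrix}X\\U\end{pmatrix}:[a,b]\to\mathbb R^{2n\times n}$ with $Y^T(t)\mathcal JY(t)=0$ and $\operatorname{rank}Y(t)=n$ for all $t\in[a,b]$. For constant matrices $Y=\begin{pmatrix}X\\U\end{pmatrix}$, $\hat Y=\begin{pmatrix}\hat X\\\hat U\end{pmatrix}$ with these two properties let $W(Y,\hat Y)=Y^T\mathcal J\hat Y$, $\mathcal M=(I-X^\dagger X)W(Y,\hat Y)$, $V=I-\mathcal M^\dagger\mathcal M$, $\mathcal P=V\,W(Y,\hat Y)^TX^\dagger\hat X\,V$, where $\dagger$ is the Moore–Penrose pseudoinverse. The comparative index and the dual comparative index are $$\mu(Y,\hat Y)=\operatorname{rank}\mathcal M+\operatorname{ind}\mathcal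 P,\qquad \mu^*(Y,\hat Y)=\operatorname{rank}\mathcal M+\operatorname{ind}(-\mathcal P),$$ where $\operatorname{ind}$ denotes the number of negative eigenvalues, counted with multiplicity, of a symmetric matrix. Further let $K_Y=(Y^TY)^{-1/2}$ and $Z_Y=\begin{pmatrix}\mathcal JYK_Y& YK_Y\end{pmatrix}\in\mathbb R^{2n\times 2n}$. For a continuous Lagrangian path $Y$ on $[a,b]$ call $(D,R)$ admissible if $D=\{a=t_0<t_1<\dots<t_p=b\}$ is a finite partition and $R=\{R_k\}_{k=0}^{p-1}$ are continuous symplectic matrix functions $R_k:[t_k,t_{k+1}]\to\mathbb R^{2n\times 2n}$ such that $\operatorname{rank}W(R_k(t)E,Y(t))$ and $\operatorname{rank}\big((I\;\,0)R_k(t)E\big)$ are constant on $[t_k,t_{k+1}]$ for each $k$. The oscillation number and the dual oscillation number of $Y$ on $[a,b]$ are $$\mathcal N(Y)=\sum_{k=0}^{p-1}\Big(\mu(Y(t_{k+1}),R_k(t_{k+1})E)-\mu(Y(t_k),R_k(t_k)E)\Big),$$ $$\mathcal N^*(Y)=\sum_{k=0}^{p-1}\Big(\mu^*(Y(t_k),R_k(t_k)E)-\mu^*(Y(t_{k+1}),R_k(t_{k+1})E)\Big)$$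 for any admissible $(D,R)$. **Theorem.** Let $Y$ and $\hat Y$ be continuous Lagrangian paths on $[a,b]$. Then, all oscillation numbers below being well defined (admissible $(D,R)$ exist, and the values do not depend on their choice), $$\mathcal N(Y)-\mathcal N(\hat Y)=\mu(Y(b),\hat Y(b))-\mu(Y(a),\hat Y(a))+\mathcal N(Z_{\hat Y}^{-1}Y),$$ $$\mathcal N^*(Y)-\mathcal N^*(\hat Y)=\mu^*(Y(a),\hat Y(a))-\mu^*(Y(b),\hat Y(b))+\mathcal N^*(Z_{\hat Y}^{-1}Y),$$ where $Z_{\hat Y}(t)=Z_{\hat Y(t)}$. Moreover, both formulas remain true when $Z_{\hat Y}$ is replaced by an arbitrary continuous symplectic matrix function $\hat Z$ on $[a,b]$ with $\hat Z(t)E=\hat Y(t)$ for all $t\in[a,b]$. -/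

import Mathlib

namespace LagrangianOsc

open Matrix

/-- Real `2n × 2n` matrices, in `n × n` blocks. -/
abbrev Mat2 (n : ℕ) := Matrix (Fin n ⊕ Fin n) (Fin n ⊕ Fin n) ℝ

/-- Real `2n × n` matrices `Y = (X; U)`; the upper block is `X = Y.toRows₁`. -/
abbrev Mat21 (n : ℕ) := Matrix (Fin n ⊕ Fin n) (Fin n) ℝ

/-- The canonical skew-symmetric matrix `𝒥 = (0 I; -I 0)` (the negative of `Matrix.J`). -/
def canJ (n : ℕ) : Mat2 n := fromBlocks 0 1 (-1) 0

/-- `S` is symplectic: `Sᵀ 𝒥 S = 𝒥`. -/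
def IsSymplectic {n : ℕ} (S : Mat2 n) : Prop := Sᵀ * canJ n * S = canJ n

/-- This is Mathlib's symplectic group. -/
theorem isSymplectic_iff_mem {n : ℕ} (S : Mat2 n) :
    IsSymplectic S ↔ S ∈ Matrix.symplecticGroup (Fin n) ℝ := by
  have h : canJ n = -Matrix.J (Fin n) ℝ := by
    simp [canJ, Matrix.J, fromBlocks_neg]
  rw [IsSymplectic, SymplecticGroup.mem_iff', h, Matrix.mul_neg, Matrix.neg_mul, neg_inj]

/-- The vertical Lagrangian plane `E = (0; I)`. -/
def vertE (n : ℕ) : Mat21 n := fromRows 0 1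

/-- `Y` represents a Lagrangian plane: `Yᵀ 𝒥 Y = 0` and `rank Y = n`. -/
def IsLagrangian {n : ℕ} (Y : Mat21 n) : Prop := Yᵀ * canJ n * Y = 0 ∧ Y.rank = n

/-- A continuous Lagrangian path on `[a, b]`. -/
def IsLagrangianPath {n : ℕ} (a b : ℝ) (Y : ℝ → Mat21 n) : Prop :=
  ContinuousOn Y (Set.Icc a b) ∧ ∀ t ∈ Set.Icc a b, IsLagrangian (Y t)

/-- A continuous symplectic matrix function on `[a, b]`. -/
def IsSymplecticPath {n : ℕ} (a b : ℝ) (S : ℝ → Mat2 n) : Prop :=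
  ContinuousOn S (Set.Icc a b) ∧ ∀ t ∈ Set.Icc a b, IsSymplectic (S t)

/-- The Wronskian `W(Y, Ŷ) = Yᵀ 𝒥 Ŷ`. -/
def wronskian {n : ℕ} (Y Yh : Mat21 n) : Matrix (Fin n) (Fin n) ℝ := Yᵀ * canJ n * Yh

/-! ### The Moore–Penrose pseudoinverse -/

/-- The four Penrose equations: `B` is the Moore–Penrose pseudoinverse of the real matrix `A`. -/
structure IsPseudoinverse {m n : Type*} [Fintype m] [Fintype n]
    (A : Matrix m n ℝ) (B : Matrix n m ℝ) : Prop where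
  mul_mul_left : A * B * A = A
  mul_mul_right : B * A * B = B
  symm_left : (A * B)ᵀ = A * B
  symm_right : (B * A)ᵀ = B * A

theorem exists_isPseudoinverse {m n : Type*} [Fintype m] [Fintype n]
    (A : Matrix m n ℝ) : ∃ B, IsPseudoinverse A B := by
  classical
  have hH : (Aᵀ * A).IsHermitian := by
    simp [Matrix.IsHermitian, Matrix.conjTranspose_eq_transpose_of_trivial, Matrix.transpose_mul]
  set H := Aᵀ * A with hHdef
  have hHt : Hᵀ = H := by simp [hHdef, Matrix.transpose_mul]
  obtain ⟨G, hGt, hcomm, hHGH, hGHG⟩ : ∃ G : Matrix n n ℝ,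
      Gᵀ = G ∧ G * H = H * G ∧ H * G * H = H ∧ G * H * G = G := by
    set U : Matrix n n ℝ := (hH.eigenvectorUnitary : Matrix n n ℝ) with hU
    have hUU : Uᵀ * U = 1 := by
      have := Matrix.UnitaryGroup.star_mul_self hH.eigenvectorUnitary
      simpa [Matrix.star_eq_conjTranspose,
        Matrix.conjTranspose_eq_transpose_of_trivial] using this
    set d := hH.eigenvalues with hd
    have hs : H = U * diagonal d * Uᵀ := by
      have := hH.spectral_theorem
      rw [Unitary.conjStarAlgAut_apply] at this
      simpa [Matrix.star_eq_conjTranspose,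
        Matrix.conjTranspose_eq_transpose_of_trivial, Function.comp_def] using this
    have key : ∀ e f : n → ℝ, (U * diagonal e * Uᵀ) * (U * diagonal f * Uᵀ)
        = U * diagonal (fun i => e i * f i) * Uᵀ := by
      intro e f
      calc _ = U * diagonal e * (Uᵀ * U) * diagonal f * Uᵀ := by simp only [Matrix.mul_assoc]
        _ = _ := by rw [hUU, Matrix.mul_one, Matrix.mul_assoc U, diagonal_mul_diagonal]
    refine ⟨U * diagonal (fun i => (d i)⁻¹) * Uᵀ, ?_, ?_, ?_, ?_⟩
    · simp [Matrix.transpose_mul, Matrix.mul_assoc]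
    · rw [hs, key, key]; simp only [mul_comm]
    · rw [hs, key, key]; congr 3; funext i; exact mul_inv_mul_cancel (d i)
    · rw [hs, key, key]; congr 3; funext i
      simpa using mul_inv_mul_cancel (d i)⁻¹
  have hAGH : A * (G * H) = A := by
    have h0 : (A * (G * H) - A)ᵀ * (A * (G * H) - A) = 0 := by
      have e1 : (A * (G * H) - A)ᵀ = (H * G - 1) * Aᵀ := by
        simp [Matrix.transpose_mul, hGt, hHt, Matrix.sub_mul]
      have e2 : A * (G * H) - A = A * (G * H - 1) := by simp [Matrix.mul_sub]
      have e3 : H * (G * H - 1) = 0 := by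
        rw [Matrix.mul_sub, ← Matrix.mul_assoc, hHGH, Matrix.mul_one, sub_self]
      rw [e1, e2, Matrix.mul_assoc, ← Matrix.mul_assoc Aᵀ, ← hHdef, e3, Matrix.mul_zero]
    rw [← Matrix.conjTranspose_eq_transpose_of_trivial,
      Matrix.conjTranspose_mul_self_eq_zero] at h0
    exact sub_eq_zero.mp h0
  refine ⟨G * Aᵀ, ?_, ?_, ?_, ?_⟩
  · rw [Matrix.mul_assoc, Matrix.mul_assoc, ← hHdef, hAGH]
  · rw [Matrix.mul_assoc G, ← hHdef, ← Matrix.mul_assoc, hGHG]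
  · simp [Matrix.transpose_mul, hGt, Matrix.mul_assoc]
  · rw [Matrix.mul_assoc, ← hHdef, Matrix.transpose_mul, hGt, hHt, hcomm]

theorem IsPseudoinverse.unique {m n : Type*} [Fintype m] [Fintype n]
    {A : Matrix m n ℝ} {B C : Matrix n m ℝ} (hB : IsPseudoinverse A B)
    (hC : IsPseudoinverse A C) : B = C := by
  have h1 : A * B = A * C := by
    calc A * B = (A * C * A) * B := by rw [hC.mul_mul_left]
      _ = (A * C)ᵀ * (A * B)ᵀ := by rw [hC.symm_left, hB.symm_left, ← Matrix.mul_assoc]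
      _ = (A * B * A * C)ᵀ := by rw [← Matrix.transpose_mul, ← Matrix.mul_assoc]
      _ = A * C := by rw [hB.mul_mul_left, hC.symm_left]
  have h2 : B * A = C * A := by
    calc B * A = B * (A * C * A) := by rw [hC.mul_mul_left]
      _ = (B * A)ᵀ * (C * A)ᵀ := by
        rw [hC.symm_right, hB.symm_right]; simp only [Matrix.mul_assoc]
      _ = (C * (A * B * A))ᵀ := by
        rw [← Matrix.transpose_mul]; simp only [Matrix.mul_assoc]
      _ = C * A := by rw [hB.mul_mul_left, hC.symm_right]
  calc B = B * A * B := hB.mul_mul_right.symm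
    _ = C * A * B := by rw [h2]
    _ = C * (A * B) := Matrix.mul_assoc _ _ _
    _ = C * A * C := by rw [h1, Matrix.mul_assoc]
    _ = C := hC.mul_mul_right

/-- The Moore–Penrose pseudoinverse `A†` of a real matrix. -/
noncomputable def pinv {m n : Type*} [Fintype m] [Fintype n]
    (A : Matrix m n ℝ) : Matrix n m ℝ :=
  Classical.choose (exists_isPseudoinverse A)

theorem pinv_spec {m n : Type*} [Fintype m] [Fintype n] (A : Matrix m n ℝ) :
    IsPseudoinverse A (pinv A) :=
  Classical.choose_spec (exists_isPseudoinverse A)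

/-! ### Comparative indices -/

/-- `ind P`: the number of negative eigenvalues, with multiplicity, of a symmetric matrix `P`. -/
noncomputable def negIndex {n : ℕ} (P : Matrix (Fin n) (Fin n) ℝ) : ℕ :=
  (P.charpoly.roots.filter (fun x => x < 0)).card

/-- `ℳ = (I - X† X) W(Y, Ŷ)`. -/
noncomputable def compM {n : ℕ} (Y Yh : Mat21 n) : Matrix (Fin n) (Fin n) ℝ :=
  (1 - pinv Y.toRows₁ * Y.toRows₁) * wronskian Y Yh

/-- `V = I - ℳ† ℳ`. -/
noncomputable def compV {n : ℕ} (Y Yh : Mat21 n) : Matrix (Fin n) (Fin n) ℝ :=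
  1 - pinv (compM Y Yh) * compM Y Yh

/-- `𝒫 = V W(Y, Ŷ)ᵀ X† X̂ V`. -/
noncomputable def compP {n : ℕ} (Y Yh : Mat21 n) : Matrix (Fin n) (Fin n) ℝ :=
  compV Y Yh * (wronskian Y Yh)ᵀ * pinv Y.toRows₁ * Yh.toRows₁ * compV Y Yh

/-- The comparative index `μ(Y, Ŷ) = rank ℳ + ind 𝒫`. -/
noncomputable def compIndex {n : ℕ} (Y Yh : Mat21 n) : ℤ :=
  ((compM Y Yh).rank : ℤ) + (negIndex (compP Y Yh) : ℤ)

/-- The dual comparative index `μ*(Y, Ŷ) = rank ℳ + ind (-𝒫)`. -/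
noncomputable def dualCompIndex {n : ℕ} (Y Yh : Mat21 n) : ℤ :=
  ((compM Y Yh).rank : ℤ) + (negIndex (-compP Y Yh) : ℤ)

/-! ### The symplectic orthogonal matrix of a Lagrangian plane -/

/-- `K_Y = (Yᵀ Y)^(-1/2)`, by the functional calculus of symmetric matrices. -/
noncomputable def normK {n : ℕ} (Y : Mat21 n) : Matrix (Fin n) (Fin n) ℝ :=
  cfc (fun x : ℝ => x ^ (-(1 / 2) : ℝ)) (Yᵀ * Y)

/-- `Z_Y = (𝒥 Y K_Y, Y K_Y)`. -/
noncomputable def matZ {n : ℕ} (Y : Mat21 n) : Mat2 n :=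
  fromCols (canJ n * Y * normK Y) (Y * normK Y)

/-! ### Oscillation numbers -/

/-- An admissible partition `a = t₀ < t₁ < ⋯ < t_p = b` (only the values `t k` with `k ≤ p` matter)
together with symplectic matrix functions `R k`, `k < p`, such that on `[t k, t (k+1)]` the function
`R k` is continuous and `rank W(R_k(s) E, Y(s))` and `rank ((I 0) R_k(s) E)` are constant. -/
structure IsAdmissible {n : ℕ} (a b : ℝ) (Y : ℝ → Mat21 n)
    (p : ℕ) (t : ℕ → ℝ) (R : ℕ → ℝ → Mat2 n) : Prop where
  left : t 0 = a
  right : t p = b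
  lt : ∀ k < p, t k < t (k + 1)
  symplectic : ∀ k < p, IsSymplecticPath (t k) (t (k + 1)) (R k)
  rank_wronskian : ∀ k < p, ∃ r : ℕ, ∀ s ∈ Set.Icc (t k) (t (k + 1)),
    (wronskian (R k s * vertE n) (Y s)).rank = r
  rank_upper : ∀ k < p, ∃ r : ℕ, ∀ s ∈ Set.Icc (t k) (t (k + 1)),
    (R k s * vertE n).toRows₁.rank = r

/-- `𝒩(Y, D, R) = ∑ k < p, μ(Y(s), R_k(s) E) |_{t_k}^{t_{k+1}}`. -/
noncomputable def oscSum {n : ℕ} (Y : ℝ → Mat21 n)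
    (p : ℕ) (t : ℕ → ℝ) (R : ℕ → ℝ → Mat2 n) : ℤ :=
  ∑ k ∈ Finset.range p, (compIndex (Y (t (k + 1))) (R k (t (k + 1)) * vertE n)
    - compIndex (Y (t k)) (R k (t k) * vertE n))

/-- `𝒩*(Y, D, R) = ∑ k < p, μ*(Y(s), R_k(s) E) |_{t_{k+1}}^{t_k}`. -/
noncomputable def dualOscSum {n : ℕ} (Y : ℝ → Mat21 n)
    (p : ℕ) (t : ℕ → ℝ) (R : ℕ → ℝ → Mat2 n) : ℤ :=
  ∑ k ∈ Finset.range p, (dualCompIndex (Y (t k)) (R k (t k) * vertE n)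
    - dualCompIndex (Y (t (k + 1))) (R k (t (k + 1)) * vertE n))

/-- `z` is the value of `𝒩(Y, D, R)` for some admissible `(D, R)`. -/
def IsOscValue {n : ℕ} (a b : ℝ) (Y : ℝ → Mat21 n) (z : ℤ) : Prop :=
  ∃ p t R, IsAdmissible a b Y p t R ∧ oscSum Y p t R = z

/-- `z` is the value of `𝒩*(Y, D, R)` for some admissible `(D, R)`. -/
def IsDualOscValue {n : ℕ} (a b : ℝ) (Y : ℝ → Mat21 n) (z : ℤ) : Prop :=
  ∃ p t R, IsAdmissible a b Y p t R ∧ dualOscSum Y p t R = z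

/-- The oscillation numbers of `Y` on `[a, b]` are well defined: an admissible `(D, R)` exists, and
the values `𝒩(Y, D, R)` and `𝒩*(Y, D, R)` do not depend on its choice. -/
def OscWellDefined {n : ℕ} (a b : ℝ) (Y : ℝ → Mat21 n) : Prop :=
  (∃! z, IsOscValue a b Y z) ∧ (∃! z, IsDualOscValue a b Y z)

open Classical in
/-- The oscillation number `𝒩(Y, [a, b])` (meaningful under `OscWellDefined`). -/
noncomputable def oscNumber {n : ℕ} (a b : ℝ) (Y : ℝ → Mat21 n) : ℤ :=
  if h : ∃ z, IsOscValue a b Y z then Classical.choose h else 0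

open Classical in
/-- The dual oscillation number `𝒩*(Y, [a, b])` (meaningful under `OscWellDefined`). -/
noncomputable def dualOscNumber {n : ℕ} (a b : ℝ) (Y : ℝ → Mat21 n) : ℤ :=
  if h : ∃ z, IsDualOscValue a b Y z then Classical.choose h else 0

end LagrangianOsc

set_option linter.unusedSectionVars false

/-! Everything reduces to negative indices of symmetric matrices. A Lagrangian plane Y = (X; U)
transversal to that of (I; λI) is described by the symmetric matrix A = X(λX - U)⁻¹ (`graphMat`);
the vertical plane E has matrix 0. Up to invertible factors the Wronskian of Y and Ŷ is Â - A, so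
ranks of Wronskians are ranks of differences. At each plane all but finitely many λ are usable, and
a usable λ stays usable nearby.

The algebraic core is `signedCompIndex_eq`. With s = 1 for μ and s = -1 for μ*, the comparative
index is the coboundary ind(-sÂ) + ind(-s(A - Â)) - ind(-sA). It results from computing the inertia
of one block matrix twice: by congruence to diag(Â, A - Â), and by a generalised Schur complement
(`negInertia_fromBlocks`), which produces rank ℳ and ind(s𝒫). The same formula holds after moving
all planes by a symplectic Z, with the matrix of ZE subtracted where E contributed 0.

On an admissible piece the two terms containing R_k E have constant rank, hence locally constant
index. So an oscillation number is, up to sign, the total increment of a function whose local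
changes are those of -ind(-s(A_{ZY} - A_{ZE})), for every continuous symplectic frame Z
(`IsAdmissible.exists_primitive`). The right side does not involve (D, R), which gives independence
of the choice.

For the comparison use the frame I for Y and for Ŷ, and the frame Z with ZE = ŶK for Z⁻¹Y. The local
changes are then those of -ind(-sA), -ind(-sÂ) and -ind(-s(A - Â)). By the coboundary formula the
defect of the claimed identity is locally constant on [a, b], hence constant. -/

namespace LagrangianOsc

open Matrix

/-! ### Negative index of symmetric matrices -/

section Inertia

open Polynomial

variable {ι κ : Type*} [Fintype ι] [DecidableEq ι] [Fintype κ] [DecidableEq κ]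

/-- The number of negative roots, with multiplicity, of the characteristic polynomial. -/
noncomputable def negInertia (A : Matrix ι ι ℝ) : ℕ :=
  (A.charpoly.roots.filter (fun x => x < 0)).card

theorem exists_orthogonal_diagonalization {A : Matrix ι ι ℝ} (hA : Aᵀ = A) :
    ∃ (U : Matrix ι ι ℝ) (d : ι → ℝ), Uᵀ * U = 1 ∧ U * Uᵀ = 1 ∧ A = U * diagonal d * Uᵀ := by
  have hH : A.IsHermitian := by
    simpa [Matrix.IsHermitian, Matrix.conjTranspose_eq_transpose_of_trivial] using hA
  have h1 := Matrix.UnitaryGroup.star_mul_self hH.eigenvectorUnitary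
  have h2 : (hH.eigenvectorUnitary : Matrix ι ι ℝ)ᵀ * hH.eigenvectorUnitary = 1 := by
    simpa [Matrix.star_eq_conjTranspose,
      Matrix.conjTranspose_eq_transpose_of_trivial] using h1
  refine ⟨hH.eigenvectorUnitary, hH.eigenvalues, h2, mul_eq_one_comm.mp h2, ?_⟩
  have := hH.spectral_theorem
  rw [Unitary.conjStarAlgAut_apply] at this
  simpa [Matrix.star_eq_conjTranspose,
    Matrix.conjTranspose_eq_transpose_of_trivial, Function.comp_def] using this

theorem negInertia_conj_diagonal {U : Matrix ι ι ℝ} (hU : Uᵀ * U = 1) (d : ι → ℝ) :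
    negInertia (U * diagonal d * Uᵀ) = Fintype.card {i // d i < 0} := by
  have h : (U * diagonal d * Uᵀ).charpoly = (diagonal d).charpoly := by
    rw [Matrix.mul_assoc, Matrix.charpoly_mul_comm, Matrix.mul_assoc, hU, Matrix.mul_one]
  rw [negInertia, h, charpoly_diagonal, Finset.prod_eq_multiset_prod,
    show Multiset.map (fun i => X - C (d i)) Finset.univ.val =
      Multiset.map (fun a => X - C a) (Multiset.map d Finset.univ.val) by
        rw [Multiset.map_map]; rfl,
    roots_multiset_prod_X_sub_C, Multiset.filter_map, Multiset.card_map, Fintype.card_subtype]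
  rfl

theorem negInertia_add_negInertia_neg {A : Matrix ι ι ℝ} (hA : Aᵀ = A) :
    negInertia A + negInertia (-A) = A.rank := by
  obtain ⟨U, d, hU, hU', rfl⟩ := exists_orthogonal_diagonalization hA
  have hn : -(U * diagonal d * Uᵀ) = U * diagonal (fun i => -d i) * Uᵀ := by
    rw [← diagonal_neg, Matrix.mul_neg, Matrix.neg_mul]
  have hr : (U * diagonal d * Uᵀ).rank = (diagonal d).rank := by
    rw [rank_mul_eq_left_of_isUnit_det _ _ (isUnit_det_of_right_inverse hU),
      rank_mul_eq_right_of_isUnit_det _ _ (isUnit_det_of_left_inverse hU)]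
  rw [hn, negInertia_conj_diagonal hU, negInertia_conj_diagonal hU, hr, rank_diagonal]
  simp only [Fintype.card_subtype]
  rw [← Finset.card_union_of_disjoint]
  · congr 1
    ext i
    simp [lt_or_lt_iff_ne]
  · rw [Finset.disjoint_filter]
    intro i _ h h'
    linarith

/-- The form `A` is negative definite on the columns of some matrix with `k` columns. -/
def HasNegDef (A : Matrix ι ι ℝ) (k : ℕ) : Prop :=
  ∃ F : Matrix ι (Fin k) ℝ, ∀ x : Fin k → ℝ, x ≠ 0 → x ⬝ᵥ (Fᵀ * A * F) *ᵥ x < 0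

theorem dotProduct_conj_mulVec (F : Matrix ι κ ℝ) (A : Matrix ι ι ℝ) (x : κ → ℝ) :
    x ⬝ᵥ (Fᵀ * A * F) *ᵥ x = (F *ᵥ x) ⬝ᵥ A *ᵥ (F *ᵥ x) := by
  rw [← mulVec_mulVec, ← mulVec_mulVec, dotProduct_mulVec, vecMul_transpose]

/-- Variational characterisation of the index: it turns eigenvalue counts into a condition that
pulls back under congruence and is open in the matrix. -/
theorem hasNegDef_iff {A : Matrix ι ι ℝ} (hA : Aᵀ = A) (k : ℕ) :
    HasNegDef A k ↔ k ≤ negInertia A := by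
  obtain ⟨U, d, hU, hU', rfl⟩ := exists_orthogonal_diagonalization hA
  rw [negInertia_conj_diagonal hU]
  have hq : ∀ y : ι → ℝ, y ⬝ᵥ (U * diagonal d * Uᵀ) *ᵥ y = ∑ i, d i * (Uᵀ *ᵥ y) i ^ 2 := by
    intro y
    have h := dotProduct_conj_mulVec Uᵀ (diagonal d) y
    rw [transpose_transpose] at h
    rw [h, dotProduct]
    exact Finset.sum_congr rfl fun i _ => by rw [mulVec_diagonal]; ring
  constructor
  · rintro ⟨F, hF⟩
    by_contra hlt
    push Not at hlt
    -- `f` keeps the coordinates of `F x` along the negative eigenvectors. With too few of these it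
    -- has a kernel, on which the form is nonnegative.
    let f : (Fin k → ℝ) →ₗ[ℝ] ({i // d i < 0} → ℝ) :=
      (LinearMap.funLeft ℝ ℝ Subtype.val) ∘ₗ (Uᵀ * F).mulVecLin
    have hk : LinearMap.ker f ≠ ⊥ := by
      apply LinearMap.ker_ne_bot_of_finrank_lt
      simpa using hlt
    obtain ⟨x, hx, hx0⟩ := Submodule.exists_mem_ne_zero_of_ne_bot hk
    have h1 := hF x hx0
    rw [dotProduct_conj_mulVec, hq] at h1
    refine absurd h1 (not_lt.mpr (Finset.sum_nonneg fun i _ => ?_))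
    by_cases hi : d i < 0
    · have := congrFun (LinearMap.mem_ker.mp hx) ⟨i, hi⟩
      have h2 : (Uᵀ *ᵥ F *ᵥ x) i = 0 := by
        rw [mulVec_mulVec]; exact this
      rw [h2]; simp
    · exact mul_nonneg (not_lt.mp hi) (sq_nonneg _)
  · intro hk
    obtain ⟨e⟩ : Nonempty (Fin k ↪ {i // d i < 0}) := by
      apply Function.Embedding.nonempty_of_card_le
      simpa using hk
    let g : Fin k → ι := fun j => (e j).1
    have hg : Function.Injective g := fun i j h => e.injective (Subtype.ext h)
    -- The columns are `k` distinct eigenvectors with negative eigenvalue.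
    let F : Matrix ι (Fin k) ℝ := U * Matrix.of fun i j => if i = g j then (1 : ℝ) else 0
    refine ⟨F, fun x hx => ?_⟩
    rw [dotProduct_conj_mulVec, hq]
    have hc : ∀ i, (Uᵀ *ᵥ F *ᵥ x) i = ∑ j, if i = g j then x j else 0 := by
      intro i
      rw [mulVec_mulVec, ← Matrix.mul_assoc, hU, Matrix.one_mul]
      simp [mulVec, dotProduct]
    have hv : ∀ j, (Uᵀ *ᵥ F *ᵥ x) (g j) = x j := by
      intro j; rw [hc]
      simp [hg.eq_iff]
    have hz : ∀ i, ¬ d i < 0 → (Uᵀ *ᵥ F *ᵥ x) i = 0 := by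
      intro i hi; rw [hc]
      refine Finset.sum_eq_zero fun j _ => if_neg ?_
      rintro rfl
      exact hi (e j).2
    obtain ⟨j, hj⟩ := Function.ne_iff.mp hx
    refine Finset.sum_neg' (fun i _ => ?_) ⟨g j, Finset.mem_univ _, ?_⟩
    · by_cases hi : d i < 0
      · exact mul_nonpos_of_nonpos_of_nonneg hi.le (sq_nonneg _)
      · rw [hz i hi]; simp
    · rw [hv]
      exact mul_neg_of_neg_of_pos (e j).2 (by have : x j ≠ 0 := hj; positivity)

theorem HasNegDef.of_conj {A : Matrix ι ι ℝ} (G : Matrix ι κ ℝ) {k : ℕ}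
    (h : HasNegDef (Gᵀ * A * G) k) : HasNegDef A k := by
  obtain ⟨F, hF⟩ := h
  refine ⟨G * F, fun x hx => ?_⟩
  have := hF x hx
  rwa [show (G * F)ᵀ * A * (G * F) = Fᵀ * (Gᵀ * A * G) * F by
    simp only [Matrix.transpose_mul, Matrix.mul_assoc]]

theorem transpose_conj {A : Matrix ι ι ℝ} (hA : Aᵀ = A) (G : Matrix ι κ ℝ) :
    (Gᵀ * A * G)ᵀ = Gᵀ * A * G := by
  simp [Matrix.transpose_mul, hA, Matrix.mul_assoc]

/-- Sylvester's law of inertia. -/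
theorem negInertia_congr {A : Matrix ι ι ℝ} (hA : Aᵀ = A) {G : Matrix ι κ ℝ}
    {H : Matrix κ ι ℝ} (h : G * H = 1) : negInertia (Gᵀ * A * G) = negInertia A := by
  apply le_antisymm
  · rw [← hasNegDef_iff hA]
    exact ((hasNegDef_iff (transpose_conj hA G) _).mpr le_rfl).of_conj G
  · rw [← hasNegDef_iff (transpose_conj hA G)]
    apply HasNegDef.of_conj H
    rw [show Hᵀ * (Gᵀ * A * G) * H = (G * H)ᵀ * A * (G * H) by
      simp only [Matrix.transpose_mul, Matrix.mul_assoc], h]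
    simpa using (hasNegDef_iff hA _).mpr le_rfl

theorem negInertia_fromBlocks_diagonal (A : Matrix ι ι ℝ) (B : Matrix κ κ ℝ) :
    negInertia (fromBlocks A 0 0 B) = negInertia A + negInertia B := by
  rw [negInertia, charpoly_fromBlocks_zero₁₂, roots_mul, Multiset.filter_add, Multiset.card_add]
  · rfl
  · exact mul_ne_zero (charpoly_monic _).ne_zero (charpoly_monic _).ne_zero

/-- Additivity of the negative index for symmetric matrices that annihilate each other. -/
theorem negInertia_add_of_mul_eq_zero {A B : Matrix ι ι ℝ} (h : A * B = 0) :
    negInertia (A + B) = negInertia A + negInertia B := by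
  have hc : A.charpoly * B.charpoly = X ^ Fintype.card ι * (A + B).charpoly := by
    rw [charpoly, charpoly, charpoly, ← det_mul]
    -- Since AB = 0, (X - A)(X - B) = X(X - (A + B)). The extra factor X contributes only zero
    -- roots, which are not counted.
    have : charmatrix A * charmatrix B = (X : ℝ[X]) • charmatrix (A + B) := by
      have h' : (C : ℝ →+* ℝ[X]).mapMatrix A * (C : ℝ →+* ℝ[X]).mapMatrix B = 0 := by
        rw [← map_mul, h, map_zero]
      simp only [charmatrix, map_add, sub_mul, mul_sub, h', scalar_apply,
        ← smul_one_eq_diagonal, Matrix.mul_smul, Matrix.smul_mul, Matrix.mul_one, Matrix.one_mul,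
        smul_sub, smul_add]
      abel
    rw [this, det_smul]
  have hr := congrArg (fun p : ℝ[X] => (p.roots.filter (fun x => x < 0)).card) hc
  beta_reduce at hr
  rw [roots_mul (mul_ne_zero (charpoly_monic _).ne_zero (charpoly_monic _).ne_zero),
    roots_mul (mul_ne_zero (pow_ne_zero _ X_ne_zero) (charpoly_monic _).ne_zero),
    Multiset.filter_add, Multiset.filter_add, Multiset.card_add, Multiset.card_add,
    roots_pow, roots_X, Multiset.nsmul_singleton] at hr
  have h0 : Multiset.filter (fun x : ℝ => x < 0) (Multiset.replicate (Fintype.card ι) 0) = 0 := by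
    rw [Multiset.filter_eq_nil]
    intro a ha
    rw [Multiset.eq_of_mem_replicate ha]
    simp
  rw [h0, Multiset.card_zero, zero_add] at hr
  exact hr.symm

theorem rank_fromBlocks_antidiagonal (N : Matrix ι κ ℝ) :
    (fromBlocks 0 N Nᵀ 0).rank = 2 * N.rank := by
  have h1 : (N * Nᵀ)ᵀ = N * Nᵀ := by simp
  have h2 : (Nᵀ * N)ᵀ = Nᵀ * N := by simp
  have h3 : (fromBlocks 0 N Nᵀ 0)ᵀ * fromBlocks 0 N Nᵀ 0 = fromBlocks (N * Nᵀ) 0 0 (Nᵀ * N) := by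
    simp [fromBlocks_transpose, fromBlocks_multiply]
  -- The rank of the block diagonal square is obtained by adding inertias, which are additive over
  -- diagonal blocks.
  have h4 := negInertia_add_negInertia_neg
    (A := fromBlocks (N * Nᵀ) 0 0 (Nᵀ * N)) (by simp [fromBlocks_transpose])
  rw [fromBlocks_neg, neg_zero, neg_zero, negInertia_fromBlocks_diagonal,
    negInertia_fromBlocks_diagonal, ← h3, rank_transpose_mul_self] at h4
  have h5 := negInertia_add_negInertia_neg h1
  have h6 := negInertia_add_negInertia_neg h2
  rw [rank_self_mul_transpose] at h5
  rw [rank_transpose_mul_self] at h6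
  omega

/-- Conjugation by diag(1, -1) changes the sign of the matrix, so positive and negative eigenvalues
are equally many and each kind makes up half of the rank. -/
theorem negInertia_fromBlocks_antidiagonal (N : Matrix ι κ ℝ) :
    negInertia (fromBlocks 0 N Nᵀ 0) = N.rank := by
  have hs : (fromBlocks 0 N Nᵀ 0)ᵀ = fromBlocks 0 N Nᵀ 0 := by
    simp [fromBlocks_transpose]
  have h1 := negInertia_add_negInertia_neg hs
  have h2 : negInertia (-fromBlocks 0 N Nᵀ 0) = negInertia (fromBlocks 0 N Nᵀ 0) := by
    let G : Matrix (ι ⊕ κ) (ι ⊕ κ) ℝ := fromBlocks 1 0 0 (-1)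
    have hG : G * G = 1 := by simp [G, fromBlocks_multiply, fromBlocks_one]
    rw [← negInertia_congr hs hG]
    congr 1
    simp [G, fromBlocks_transpose, fromBlocks_multiply, fromBlocks_neg]
  rw [h2, rank_fromBlocks_antidiagonal] at h1
  omega

/-! ### Pseudoinverses and the inertia of block matrices -/

theorem pinv_transpose {A : Matrix ι κ ℝ} : pinv Aᵀ = (pinv A)ᵀ := by
  have h := pinv_spec A
  refine (pinv_spec Aᵀ).unique ⟨?_, ?_, ?_, ?_⟩
  · rw [← transpose_mul, ← transpose_mul, ← Matrix.mul_assoc, h.mul_mul_left]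
  · rw [← transpose_mul, ← transpose_mul, ← Matrix.mul_assoc, h.mul_mul_right]
  · rw [← transpose_mul, h.symm_right, h.symm_right]
  · rw [← transpose_mul, h.symm_left, h.symm_left]

/-- The projection `A† A` depends only on the kernel of `A`. -/
theorem pinv_mul_self_eq {ι' : Type*} [Fintype ι'] {A : Matrix ι κ ℝ} {B : Matrix ι' κ ℝ}
    {M : Matrix ι ι' ℝ} {M' : Matrix ι' ι ℝ} (hA : A = M * B) (hB : B = M' * A) :
    pinv A * A = pinv B * B := by
  have h := pinv_spec A
  have h' := pinv_spec B
  have e1 : A * (pinv B * B) = A := by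
    rw [← Matrix.mul_assoc]
    nth_rw 1 [hA]
    rw [Matrix.mul_assoc, Matrix.mul_assoc, ← Matrix.mul_assoc B, h'.mul_mul_left, ← hA]
  have e2 : B * (pinv A * A) = B := by
    rw [← Matrix.mul_assoc]
    nth_rw 1 [hB]
    rw [Matrix.mul_assoc, Matrix.mul_assoc, ← Matrix.mul_assoc A, h.mul_mul_left, ← hB]
  calc pinv A * A = (pinv A * A)ᵀ := h.symm_right.symm
    _ = (pinv A * A * (pinv B * B))ᵀ := by rw [Matrix.mul_assoc (pinv A), e1]
    _ = pinv B * B * (pinv A * A) := by rw [transpose_mul, h.symm_right, h'.symm_right]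
    _ = pinv B * B := by rw [Matrix.mul_assoc (pinv B), e2]

theorem negInertia_congr_smul (σ : ℝ) {A : Matrix ι ι ℝ} (hA : Aᵀ = A) {G : Matrix ι κ ℝ}
    {H : Matrix κ ι ℝ} (h : G * H = 1) :
    negInertia (σ • (Gᵀ * A * G)) = negInertia (σ • A) := by
  rw [← negInertia_congr (A := σ • A) (by rw [transpose_smul, hA]) h]
  simp

/-- A shear uses `N` to clear every part of `C` except its compression to ker `N`; `A` is untouched
because the shear is annihilated by it. What is left is diag(A, VCV) plus an antidiagonal matrix,
and these two annihilate each other. -/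
theorem negInertia_fromBlocks_of_mul_eq_zero {σ : ℝ} (hσ : σ ≠ 0) {A : Matrix ι ι ℝ}
    {N : Matrix ι κ ℝ} {C : Matrix κ κ ℝ} (hA : Aᵀ = A) (hC : Cᵀ = C) (hAN : A * N = 0) :
    negInertia (σ • fromBlocks A N Nᵀ C) = negInertia (σ • A) + N.rank +
      negInertia (σ • ((1 - pinv N * N) * C * (1 - pinv N * N))) := by
  have hN := pinv_spec N
  set Q := pinv N * N with hQ
  have hQt : Qᵀ = Q := hN.symm_right
  have hVt : (1 - Q)ᵀ = 1 - Q := by simp [hQt]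
  have hNV : N * (1 - Q) = 0 := by
    rw [Matrix.mul_sub, Matrix.mul_one, hQ, ← Matrix.mul_assoc, hN.mul_mul_left, sub_self]
  -- Chosen so that NᵀZ + ZᵀN = (1 - Q)C(1 - Q) - C; the block QCQ is shared equally by the two
  -- transposed terms, hence the factor 1/2.
  let Z : Matrix ι κ ℝ := -((pinv N)ᵀ * ((1 / 2 : ℝ) • (Q * C * Q) + Q * C * (1 - Q)))
  have hAp : A * (pinv N)ᵀ = 0 := by
    have : (pinv N)ᵀ = N * (pinv N * (pinv N)ᵀ) := by
      conv_lhs => rw [← hN.mul_mul_right, Matrix.mul_assoc, transpose_mul, hN.symm_left]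
      rw [Matrix.mul_assoc]
    rw [this, ← Matrix.mul_assoc, hAN, Matrix.zero_mul]
  have hAZ : A * Z = 0 := by
    simp only [Z, Matrix.mul_neg, ← Matrix.mul_assoc, hAp, Matrix.zero_mul, neg_zero]
  have hNp : Nᵀ * (pinv N)ᵀ = Q := by rw [← transpose_mul, hQt]
  have hQQ : Q * Q = Q := by rw [hQ, ← Matrix.mul_assoc, hN.mul_mul_right]
  have hNZ : Nᵀ * Z = -((1 / 2 : ℝ) • (Q * C * Q) + Q * C * (1 - Q)) := by
    simp only [Z, Matrix.mul_neg, ← Matrix.mul_assoc, hNp]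
    rw [Matrix.mul_add, Matrix.mul_smul]
    simp only [← Matrix.mul_assoc, hQQ]
  have hZN : Zᵀ * N = -((1 / 2 : ℝ) • (Q * C * Q) + (1 - Q) * C * Q) := by
    have := congrArg transpose hNZ
    rw [transpose_mul, transpose_transpose] at this
    rw [this]
    simp only [transpose_neg, transpose_add, transpose_smul, transpose_mul, hQt, hC, hVt,
      Matrix.mul_assoc]
  have hsymm : (fromBlocks A N Nᵀ C)ᵀ = fromBlocks A N Nᵀ C := by
    rw [fromBlocks_transpose, hA, hC, transpose_transpose]
  let G : Matrix (ι ⊕ κ) (ι ⊕ κ) ℝ := fromBlocks 1 Z 0 1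
  have hG : G * fromBlocks 1 (-Z) 0 1 = 1 := by
    simp [G, fromBlocks_multiply, fromBlocks_one]
  have hconj : Gᵀ * fromBlocks A N Nᵀ C * G =
      fromBlocks A N Nᵀ ((1 - Q) * C * (1 - Q)) := by
    have hZA : Zᵀ * A = 0 := by
      have := congrArg transpose hAZ
      rwa [transpose_mul, hA, transpose_zero] at this
    simp only [G, fromBlocks_transpose, fromBlocks_multiply, transpose_one, transpose_zero,
      Matrix.one_mul, Matrix.mul_one, Matrix.zero_mul, Matrix.mul_zero, add_zero, hAZ, zero_add,
      hZA, hNZ, hZN]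
    congr 1
    simp only [Matrix.mul_sub, Matrix.sub_mul, Matrix.mul_one, Matrix.one_mul]
    module
  rw [← negInertia_congr_smul σ hsymm hG, hconj]
  have hsplit : σ • fromBlocks A N Nᵀ ((1 - Q) * C * (1 - Q)) =
      fromBlocks (σ • A) 0 0 (σ • ((1 - Q) * C * (1 - Q))) +
        fromBlocks 0 (σ • N) (σ • N)ᵀ 0 := by
    simp [fromBlocks_add, fromBlocks_smul]
  have hVN : (1 - Q) * Nᵀ = 0 := by
    rw [← hVt, ← transpose_mul, hNV, transpose_zero]
  rw [hsplit, negInertia_add_of_mul_eq_zero, negInertia_fromBlocks_diagonal,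
    negInertia_fromBlocks_antidiagonal]
  · have : (σ • N).rank = N.rank := 
      rank_smul_of_mem_nonZeroDivisors N (mem_nonZeroDivisors_of_ne_zero hσ)
    omega
  · simp [fromBlocks_multiply, hAN, Matrix.mul_assoc, hVN]

/-- Inertia of a symmetric block matrix with an arbitrary diagonal block. -/
theorem negInertia_fromBlocks {σ : ℝ} (hσ : σ ≠ 0) {A : Matrix ι ι ℝ} (B : Matrix ι κ ℝ)
    {C : Matrix κ κ ℝ} (hA : Aᵀ = A) (hC : Cᵀ = C) {N : Matrix ι κ ℝ}
    (hN : N = (1 - pinv A * A) * B) :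
    negInertia (σ • fromBlocks A B Bᵀ C) = negInertia (σ • A) + N.rank +
      negInertia (σ • ((1 - pinv N * N) * (C - Bᵀ * pinv A * B) * (1 - pinv N * N))) := by
  have h := pinv_spec A
  have hpt : (pinv A)ᵀ = pinv A := by rw [← pinv_transpose, hA]
  have hcomm : A * pinv A = pinv A * A := by
    rw [← h.symm_right, transpose_mul, hA, hpt]
  have hAN : A * N = 0 := by
    rw [hN, ← Matrix.mul_assoc, Matrix.mul_sub, Matrix.mul_one, ← Matrix.mul_assoc,
      h.mul_mul_left, sub_self, Matrix.zero_mul]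
  have hCt : (C - Bᵀ * pinv A * B)ᵀ = C - Bᵀ * pinv A * B := by
    simp [transpose_mul, hC, hpt, Matrix.mul_assoc]
  rw [← negInertia_fromBlocks_of_mul_eq_zero hσ hA hCt hAN]
  -- Block elimination with A†B. When `A` is singular it removes only the part of `B` in the range
  -- of `A` and leaves `N`.
  let G : Matrix (ι ⊕ κ) (ι ⊕ κ) ℝ := fromBlocks 1 (-(pinv A * B)) 0 1
  have hG : G * fromBlocks 1 (pinv A * B) 0 1 = 1 := by
    simp [G, fromBlocks_multiply, fromBlocks_one]
  have hsymm : (fromBlocks A B Bᵀ C)ᵀ = fromBlocks A B Bᵀ C := by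
    rw [fromBlocks_transpose, hA, hC, transpose_transpose]
  rw [← negInertia_congr_smul σ hsymm hG]
  congr 2
  have e1 : A * (pinv A * B) = pinv A * A * B := by rw [← Matrix.mul_assoc, hcomm]
  have e2 : Bᵀ * pinv A * A = Bᵀ * (pinv A * A) := Matrix.mul_assoc _ _ _
  have hNt : Nᵀ = Bᵀ - Bᵀ * (pinv A * A) := by
    rw [hN, transpose_mul, transpose_sub, transpose_one, h.symm_right, Matrix.mul_sub,
      Matrix.mul_one]
  rw [hNt, hN]
  simp only [G, fromBlocks_transpose, fromBlocks_multiply, transpose_one, transpose_zero,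
    Matrix.one_mul, Matrix.mul_one, Matrix.zero_mul, Matrix.mul_zero, add_zero, transpose_neg,
    transpose_mul, hpt, Matrix.mul_neg, Matrix.neg_mul, e1, e2, Matrix.sub_mul, Matrix.add_mul]
  congr 1
  · abel
  · abel
  · have : Bᵀ * (pinv A * A) * (pinv A * B) = Bᵀ * pinv A * B := by
      rw [← Matrix.mul_assoc, Matrix.mul_assoc Bᵀ, h.mul_mul_right]
    rw [this, ← Matrix.mul_assoc]
    abel

/-! ### Semicontinuity and local constancy of the index -/

/-- The negative index is lower semicontinuous. -/
theorem eventually_hasNegDef {T : Type*} {l : Filter T} {A : T → Matrix ι ι ℝ}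
    {A₀ : Matrix ι ι ℝ} (hl : Filter.Tendsto A l (nhds A₀)) {k : ℕ} (h : HasNegDef A₀ k) :
    ∀ᶠ t in l, HasNegDef (A t) k := by
  obtain ⟨F, hF⟩ := h
  -- By homogeneity negativity need only be checked on the unit sphere, where compactness makes it
  -- stable.
  have key : ∀ᶠ B in nhds A₀, ∀ x ∈ Metric.sphere (0 : Fin k → ℝ) 1,
      x ⬝ᵥ (Fᵀ * B * F) *ᵥ x < 0 := by
    refine (isCompact_sphere _ _).eventually_forall_of_forall_eventually fun x hx => ?_
    have hc : Continuous fun p : Matrix ι ι ℝ × (Fin k → ℝ) =>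
        p.2 ⬝ᵥ (Fᵀ * p.1 * F) *ᵥ p.2 := by fun_prop
    refine hc.continuousAt.eventually_lt_const (hF x ?_)
    rintro rfl
    simp at hx
  filter_upwards [hl.eventually key] with t ht
  refine ⟨F, fun x hx => ?_⟩
  have hx' : 0 < ‖x‖ := norm_pos_iff.mpr hx
  have := ht (‖x‖⁻¹ • x) (by simp [norm_smul, hx'.ne'])
  rw [mulVec_smul, dotProduct_smul, smul_dotProduct, smul_eq_mul, smul_eq_mul, ← mul_assoc] at this
  exact neg_of_mul_neg_right this (by positivity)

/-- The negative index is locally constant along symmetric matrices of constant rank. -/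
theorem eventually_negInertia_eq {T : Type*} {l : Filter T} {A : T → Matrix ι ι ℝ}
    {A₀ : Matrix ι ι ℝ} (hl : Filter.Tendsto A l (nhds A₀)) (h₀ : A₀ᵀ = A₀)
    (hs : ∀ᶠ t in l, (A t)ᵀ = A t) (hr : ∀ᶠ t in l, (A t).rank = A₀.rank) :
    ∀ᶠ t in l, negInertia (A t) = negInertia A₀ := by
  have h₀' : (-A₀)ᵀ = -A₀ := by rw [transpose_neg, h₀]
  -- Neither ind(A) nor ind(-A) can drop near the limit, and their sum is the fixed rank, so neither
  -- can grow.
  filter_upwards [hs, hr, eventually_hasNegDef hl ((hasNegDef_iff h₀ _).mpr le_rfl),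
    eventually_hasNegDef hl.neg ((hasNegDef_iff h₀' _).mpr le_rfl)] with t h1 h2 h3 h4
  have h1' : (-A t)ᵀ = -A t := by rw [transpose_neg, h1]
  rw [hasNegDef_iff h1] at h3
  rw [hasNegDef_iff h1'] at h4
  have := negInertia_add_negInertia_neg h₀
  have := negInertia_add_negInertia_neg h1
  omega

end Inertia

/-! ### The comparative index as a coboundary -/

section ComparativeIndex

variable {n : ℕ}

/-- Both comparative indices at once: `s = 1` gives `μ`, `s = -1` gives `μ*`. -/
noncomputable def signedCompIndex (s : ℝ) (Y Yh : Mat21 n) : ℤ :=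
  ((compM Y Yh).rank : ℤ) + (negIndex (s • compP Y Yh) : ℤ)

theorem signedCompIndex_one (Y Yh : Mat21 n) : signedCompIndex 1 Y Yh = compIndex Y Yh := by
  rw [signedCompIndex, one_smul, compIndex]

theorem signedCompIndex_neg_one (Y Yh : Mat21 n) :
    signedCompIndex (-1) Y Yh = dualCompIndex Y Yh := by
  rw [signedCompIndex, neg_one_smul, dualCompIndex]

/-- The comparative index of two planes given by symmetric matrices is a coboundary of negative
indices. -/
theorem signedCompIndex_eq {s : ℝ} (hs : s ≠ 0) {Y Yh : Mat21 n}
    {L G Gh A Ah : Matrix (Fin n) (Fin n) ℝ} (hL : IsUnit L.det) (hG : IsUnit G.det)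
    (hGh : IsUnit Gh.det) (hA : Aᵀ = A) (hAh : Ahᵀ = Ah)
    (hX : Y.toRows₁ = L * A * G) (hXh : Yh.toRows₁ = L * Ah * Gh)
    (hW : wronskian Y Yh = Gᵀ * (Ah - A) * Gh) :
    signedCompIndex s Y Yh = (negInertia (-s • Ah) : ℤ) + negInertia (-s • (A - Ah))
      - negInertia (-s • A) := by
  set X := Y.toRows₁ with hXdef
  set Xh := Yh.toRows₁ with hXhdef
  set W := wronskian Y Yh with hWdef
  have hGt : IsUnit Gᵀ.det := by rwa [det_transpose]
  set A' := Gᵀ * A * G with hA'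
  set B := Gᵀ * Ah * Gh with hB
  set C := Ghᵀ * Ah * Gh with hC
  have hA't : A'ᵀ = A' := transpose_conj hA G
  have hCt : Cᵀ = C := transpose_conj hAh Gh
  -- `X` and `A'` differ by an invertible left factor, so they have the same kernel and the same
  -- projection. The pseudoinverse of `X` itself cancels later.
  have hp : pinv X * X = pinv A' * A' := by
    refine pinv_mul_self_eq (M := L * Gᵀ⁻¹) (M' := Gᵀ * L⁻¹) ?_ ?_
    · rw [hX, hA', Matrix.mul_assoc L Gᵀ⁻¹, Matrix.mul_assoc Gᵀ, nonsing_inv_mul_cancel_left _ _ hGt,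
        Matrix.mul_assoc]
    · rw [hX, hA', Matrix.mul_assoc Gᵀ L⁻¹, Matrix.mul_assoc L, nonsing_inv_mul_cancel_left _ _ hL,
        Matrix.mul_assoc]
  have hps := pinv_spec A'
  have hpt : (pinv A')ᵀ = pinv A' := by rw [← pinv_transpose, hA't]
  have hcomm : A' * pinv A' = pinv A' * A' := by
    rw [← hps.symm_right, transpose_mul, hA't, hpt]
  set K := 1 - pinv A' * A' with hK
  have hKA : K * A' = 0 := by
    rw [hK, Matrix.sub_mul, Matrix.one_mul, ← hcomm, hps.mul_mul_left, sub_self]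
  have hWB : W = B - A' * (G⁻¹ * Gh) := by
    rw [hW, hB, hA', Matrix.mul_assoc (Gᵀ * A), mul_nonsing_inv_cancel_left _ _ hG,
      Matrix.mul_sub, Matrix.sub_mul]
  set N := compM Y Yh with hN
  have hNW : N = K * W := by
    rw [hN, compM, ← hXdef, hp]
  have hNB : N = K * B := by
    rw [hNW, hWB, Matrix.mul_sub, ← Matrix.mul_assoc K A', hKA, Matrix.zero_mul, sub_zero]
  set V := 1 - pinv N * N with hV
  have hNs := pinv_spec N
  have hVt : Vᵀ = V := by rw [hV, transpose_sub, transpose_one, hNs.symm_right]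
  have hNV : N * V = 0 := by
    rw [hV, Matrix.mul_sub, Matrix.mul_one, ← Matrix.mul_assoc, hNs.mul_mul_left, sub_self]
  -- On the range of `V` the columns of `B` lie in the range of `A'`, because K(BV) = NV = 0. Hence
  -- X̂V = Xc, and X† enters `compP` only through the projection X†X.
  set c := pinv A' * (B * V) with hc
  have hBV : B * V = A' * c := by
    have h0 : K * (B * V) = 0 := by rw [← Matrix.mul_assoc, ← hNB, hNV]
    rw [hK, Matrix.sub_mul, Matrix.one_mul, sub_eq_zero] at h0
    rw [hc, ← Matrix.mul_assoc, hcomm, ← h0]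
  have hAV : Ah * Gh * V = A * G * c := by
    have h1 := congrArg (fun M => Gᵀ⁻¹ * M) hBV
    simp only [hB, hA', Matrix.mul_assoc, nonsing_inv_mul_cancel_left _ _ hGt] at h1
    simpa only [Matrix.mul_assoc] using h1
  have hXV : Xh * V = X * c := by
    rw [hXh, hX]
    simp only [Matrix.mul_assoc] at hAV ⊢
    rw [hAV]
  have hVW : V * Wᵀ * (pinv X * X) = V * Wᵀ := by
    have h0 : K * (W * V) = 0 := by rw [← Matrix.mul_assoc, ← hNW, hNV]
    rw [hK, Matrix.sub_mul, Matrix.one_mul, sub_eq_zero, ← hp] at h0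
    have h1 := congrArg transpose h0
    rw [transpose_mul, transpose_mul, transpose_mul, (pinv_spec X).symm_right, hVt] at h1
    exact h1.symm
  have hWVt : V * Wᵀ = cᵀ * A' - V * (Ghᵀ * Gᵀ⁻¹) * A' := by
    have h1 : W * V = A' * c - A' * (G⁻¹ * Gh * V) := by
      rw [hWB, Matrix.sub_mul, hBV, Matrix.mul_assoc A']
    have h2 := congrArg transpose h1
    simpa only [transpose_mul, transpose_sub, hVt, hA't, transpose_nonsing_inv,
      Matrix.mul_assoc] using h2
  have hP : compP Y Yh = -(V * (C - Bᵀ * pinv A' * B) * V) := by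
    have e1 : compP Y Yh = cᵀ * A' * c - V * C * V := by
      calc compP Y Yh = V * Wᵀ * pinv X * (Xh * V) := by
            rw [compP, compV, ← hN, ← hV, Matrix.mul_assoc _ Xh]
        _ = V * Wᵀ * c := by
            rw [hXV, ← Matrix.mul_assoc, Matrix.mul_assoc _ (pinv X), hVW]
        _ = cᵀ * A' * c - V * (Ghᵀ * Gᵀ⁻¹) * (B * V) := by
            rw [hWVt, Matrix.sub_mul, Matrix.mul_assoc _ A' c, Matrix.mul_assoc _ A' c, hBV]
        _ = _ := by
            congr 1
            simp only [hB, hC, Matrix.mul_assoc, nonsing_inv_mul_cancel_left _ _ hGt]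
    have e2 : V * (Bᵀ * pinv A' * B) * V = cᵀ * A' * c := by
      have h2 := congrArg transpose hBV
      rw [transpose_mul B V, transpose_mul A' c, hVt, hA't] at h2
      rw [← h2, hc]
      simp only [Matrix.mul_assoc]
    rw [e1, Matrix.mul_sub V C, Matrix.sub_mul (V * C), e2, neg_sub]
  have hs' : -s ≠ 0 := neg_ne_zero.mpr hs
  have hblock := negInertia_fromBlocks hs' B hA't hCt hNB
  rw [← hV, negInertia_congr_smul _ hA (mul_nonsing_inv G hG)] at hblock
  have hcong : negInertia (-s • fromBlocks A' B Bᵀ C) =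
      negInertia (-s • Ah) + negInertia (-s • (A - Ah)) := by
    -- The substitution (x, y) ↦ (Gx + Ĝy, Gx) in the form diag(Â, A - Â).
    let T : Matrix (Fin n ⊕ Fin n) (Fin n ⊕ Fin n) ℝ := fromBlocks G Gh G 0
    let T' : Matrix (Fin n ⊕ Fin n) (Fin n ⊕ Fin n) ℝ := fromBlocks 0 G⁻¹ Gh⁻¹ (-Gh⁻¹)
    have hT : T * T' = 1 := by
      simp [T, T', fromBlocks_multiply, mul_nonsing_inv _ hG, mul_nonsing_inv _ hGh,
        fromBlocks_one]
    have h1 : fromBlocks A' B Bᵀ C = Tᵀ * fromBlocks Ah 0 0 (A - Ah) * T := by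
      simp only [T, fromBlocks_transpose, fromBlocks_multiply, hA', hB, hC, transpose_mul, hAh,
        transpose_transpose, transpose_zero, Matrix.mul_zero, Matrix.zero_mul, add_zero, zero_add,
        Matrix.mul_sub, Matrix.sub_mul, Matrix.mul_assoc]
      congr 1 <;> abel
    have h2 : (fromBlocks Ah 0 0 (A - Ah))ᵀ = fromBlocks Ah 0 0 (A - Ah) := by
      simp [fromBlocks_transpose, hAh, hA]
    rw [h1, negInertia_congr_smul _ h2 hT, fromBlocks_smul,
      smul_zero (-s), negInertia_fromBlocks_diagonal]
  have hPs : s • compP Y Yh = -s • (V * (C - Bᵀ * pinv A' * B) * V) := by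
    rw [hP, smul_neg, neg_smul]
  have hI : negIndex (s • compP Y Yh) =
      negInertia (-s • (V * (C - Bᵀ * pinv A' * B) * V)) := by
    rw [hPs]; rfl
  rw [signedCompIndex, hI, ← hN]
  omega

end ComparativeIndex

/-! ### Lagrangian planes as symmetric matrices -/

section GraphCoordinates

variable {n : ℕ}

theorem isUnit_det_of_rank_eq {A : Matrix (Fin n) (Fin n) ℝ} (h : A.rank = n) : IsUnit A.det := by
  rw [← isUnit_iff_isUnit_det, ← mulVec_surjective_iff_isUnit]
  change Function.Surjective A.mulVecLin
  rw [← LinearMap.range_eq_top]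
  apply Submodule.eq_top_of_finrank_eq
  rw [Module.finrank_fin_fun]
  exact h

theorem wronskian_eq_blocks (Y Yh : Mat21 n) :
    wronskian Y Yh = Y.toRows₁ᵀ * Yh.toRows₂ - Y.toRows₂ᵀ * Yh.toRows₁ := by
  conv_lhs => rw [← fromRows_toRows Y, ← fromRows_toRows Yh]
  rw [wronskian, canJ, Matrix.mul_assoc, fromBlocks_mul_fromRows, transpose_fromRows,
    fromCols_mul_fromRows]
  simp [sub_eq_add_neg]

theorem wronskian_vertE (Y : Mat21 n) : wronskian (vertE n) Y = -Y.toRows₁ := by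
  simp [wronskian_eq_blocks, vertE]

theorem IsLagrangian.wronskian_self {Y : Mat21 n} (h : IsLagrangian Y) : wronskian Y Y = 0 := h.1

theorem isLagrangian_vertE : IsLagrangian (vertE n) := by
  refine ⟨?_, ?_⟩
  · change wronskian _ _ = 0
    rw [wronskian_vertE]
    simp [vertE]
  · have h : (vertE n)ᵀ * vertE n = 1 := by
      rw [vertE, transpose_fromRows, fromCols_mul_fromRows]; simp
    rw [← rank_transpose_mul_self, h, rank_one, Fintype.card_fin]

theorem IsSymplectic.isUnit_det {Z : Mat2 n} (h : IsSymplectic Z) : IsUnit Z.det :=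
  SymplecticGroup.symplectic_det ((isSymplectic_iff_mem Z).mp h)

theorem IsSymplectic.wronskian_mul {Z : Mat2 n} (h : IsSymplectic Z) (Y Yh : Mat21 n) :
    wronskian (Z * Y) (Z * Yh) = wronskian Y Yh := by
  have h' : Zᵀ * canJ n * Z = canJ n := h
  rw [wronskian, wronskian]
  conv_rhs => rw [← h']
  simp only [transpose_mul, Matrix.mul_assoc]

theorem IsSymplectic.mul_isLagrangian {Z : Mat2 n} (h : IsSymplectic Z) {Y : Mat21 n}
    (hY : IsLagrangian Y) : IsLagrangian (Z * Y) :=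
  ⟨(h.wronskian_mul Y Y).trans hY.1, (rank_mul_eq_right_of_isUnit_det _ _ h.isUnit_det).trans hY.2⟩

theorem IsSymplectic.inv {Z : Mat2 n} (h : IsSymplectic Z) : IsSymplectic Z⁻¹ := by
  have h' : Zᵀ * canJ n * Z = canJ n := h
  rw [IsSymplectic, transpose_nonsing_inv]
  have hu : IsUnit Zᵀ.det := by rw [det_transpose]; exact h.isUnit_det
  conv_lhs => rw [← h']
  rw [Matrix.mul_assoc, Matrix.mul_assoc, Matrix.mul_assoc, mul_nonsing_inv _ h.isUnit_det,
    Matrix.mul_one, nonsing_inv_mul_cancel_left _ _ hu]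

/-- `λ X - U`, which is invertible iff the plane of `Y = (X; U)` is transversal to that of
`(I; λ I)`. -/
noncomputable def frameDen (lam : ℝ) (Y : Mat21 n) : Matrix (Fin n) (Fin n) ℝ :=
  lam • Y.toRows₁ - Y.toRows₂

/-- The symmetric matrix of a Lagrangian plane transversal to that of `(I; λ I)`. -/
noncomputable def graphMat (lam : ℝ) (Y : Mat21 n) : Matrix (Fin n) (Fin n) ℝ :=
  Y.toRows₁ * (frameDen lam Y)⁻¹

/-- The plane of `Y` is transversal to that of `(I; λ I)`. -/
def IsGraph (lam : ℝ) (Y : Mat21 n) : Prop := IsUnit (frameDen lam Y).det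

theorem wronskian_eq_frameDen (lam : ℝ) (Y Yh : Mat21 n) :
    wronskian Y Yh = (frameDen lam Y)ᵀ * Yh.toRows₁ - Y.toRows₁ᵀ * frameDen lam Yh := by
  rw [wronskian_eq_blocks, frameDen, frameDen, transpose_sub, transpose_smul, Matrix.sub_mul,
    Matrix.mul_sub, Matrix.smul_mul, Matrix.mul_smul]
  abel

theorem IsGraph.graphMat_mul {lam : ℝ} {Y : Mat21 n} (h : IsGraph lam Y) :
    graphMat lam Y * frameDen lam Y = Y.toRows₁ := by
  rw [graphMat, nonsing_inv_mul_cancel_right _ _ h]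

theorem IsGraph.isUnit_transpose {lam : ℝ} {Y : Mat21 n} (h : IsGraph lam Y) :
    IsUnit (frameDen lam Y)ᵀ.det := by
  rw [det_transpose]; exact h

theorem IsLagrangian.graphMat_transpose {lam : ℝ} {Y : Mat21 n} (hY : IsLagrangian Y)
    (h : IsGraph lam Y) : (graphMat lam Y)ᵀ = graphMat lam Y := by
  have h0 := wronskian_eq_frameDen lam Y Y
  rw [hY.wronskian_self, eq_comm, sub_eq_zero] at h0
  have h1 := congrArg (fun M => (frameDen lam Y)ᵀ⁻¹ * M * (frameDen lam Y)⁻¹) h0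
  simp only [nonsing_inv_mul_cancel_left _ _ h.isUnit_transpose, Matrix.mul_assoc,
    mul_nonsing_inv _ h, Matrix.mul_one] at h1
  rw [graphMat, transpose_mul, transpose_nonsing_inv, h1]

/-- This identity translates both the Wronskian in `compM` and the rank conditions of admissibility
into differences of symmetric matrices. -/
theorem wronskian_eq_graphMat {lam : ℝ} {Y Yh : Mat21 n} (hY : IsLagrangian Y)
    (h : IsGraph lam Y) (hh : IsGraph lam Yh) :
    wronskian Y Yh =
      (frameDen lam Y)ᵀ * (graphMat lam Yh - graphMat lam Y) * frameDen lam Yh := by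
  rw [Matrix.mul_sub, Matrix.sub_mul, Matrix.mul_assoc, hh.graphMat_mul,
    wronskian_eq_frameDen lam]
  congr 2
  rw [← h.graphMat_mul, transpose_mul, hY.graphMat_transpose h]

theorem rank_graphMat_sub {lam : ℝ} {Y Yh : Mat21 n} (hY : IsLagrangian Y)
    (h : IsGraph lam Y) (hh : IsGraph lam Yh) :
    (graphMat lam Yh - graphMat lam Y).rank = (wronskian Y Yh).rank := by
  rw [wronskian_eq_graphMat hY h hh, rank_mul_eq_left_of_isUnit_det _ _ hh,
    rank_mul_eq_right_of_isUnit_det _ _ h.isUnit_transpose]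

theorem frameDen_mul (lam : ℝ) (Y : Mat21 n) (K : Matrix (Fin n) (Fin n) ℝ) :
    frameDen lam (Y * K) = frameDen lam Y * K := by
  have h1 : (Y * K).toRows₁ = Y.toRows₁ * K := rfl
  have h2 : (Y * K).toRows₂ = Y.toRows₂ * K := rfl
  rw [frameDen, frameDen, h1, h2, Matrix.sub_mul, Matrix.smul_mul]

theorem graphMat_mul_right (lam : ℝ) (Y : Mat21 n) {K : Matrix (Fin n) (Fin n) ℝ}
    (hK : IsUnit K.det) : graphMat lam (Y * K) = graphMat lam Y := by
  have h1 : (Y * K).toRows₁ = Y.toRows₁ * K := rfl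
  rw [graphMat, graphMat, frameDen_mul, h1, Matrix.mul_inv_rev, Matrix.mul_assoc,
    mul_nonsing_inv_cancel_left _ _ hK]

theorem IsLagrangian.isUnit_det_gram {Y : Mat21 n} (hY : IsLagrangian Y) :
    IsUnit (Yᵀ * Y).det :=
  isUnit_det_of_rank_eq (by rw [rank_transpose_mul_self, hY.2])

-- det(λX - U) is a polynomial in λ. It does not vanish at λ = i: since XᵀU = UᵀX, the product (iX -
-- U)*(iX - U) equals YᵀY, which is invertible.
open Polynomial in
theorem IsLagrangian.finite_not_isGraph {Y : Mat21 n} (hY : IsLagrangian Y) :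
    {lam : ℝ | ¬ IsGraph lam Y}.Finite := by
  let p : ℝ[X] := ((X : ℝ[X]) • Y.toRows₁.map C - Y.toRows₂.map C).det
  have hp : ∀ lam : ℝ, p.eval lam = (frameDen lam Y).det := by
    intro lam
    rw [← coe_evalRingHom, RingHom.map_det]
    congr 1
    ext i j
    simp [frameDen]; ring
  have hp0 : p ≠ 0 := by
    intro h0
    have h1 : (p.map (algebraMap ℝ ℂ)).eval Complex.I = 0 := by rw [h0]; simp
    let c : ℝ →+* ℂ := algebraMap ℝ ℂ
    let D : Matrix (Fin n) (Fin n) ℂ := Complex.I • Y.toRows₁.map c - Y.toRows₂.map c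
    have h2 : D.det = 0 := by
      rw [← h1, ← coe_evalRingHom, ← coe_mapRingHom, RingHom.map_det, RingHom.map_det]
      congr 1
      ext i j
      simp [D, c]; ring
    -- The conjugate transpose of `D`, written out.
    let D' : Matrix (Fin n) (Fin n) ℂ := -(Complex.I • Y.toRows₁ᵀ.map c) - Y.toRows₂ᵀ.map c
    have hD : D' * D = (Yᵀ * Y).map c := by
      have e1 : (Yᵀ * Y).map c = Y.toRows₁ᵀ.map c * Y.toRows₁.map c +
          Y.toRows₂ᵀ.map c * Y.toRows₂.map c := by
        conv_lhs => rw [← fromRows_toRows Y, transpose_fromRows, fromCols_mul_fromRows]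
        rw [← Matrix.map_mul, ← Matrix.map_mul, Matrix.map_add _ (map_add c)]
      have e2 : Y.toRows₁ᵀ.map c * Y.toRows₂.map c = Y.toRows₂ᵀ.map c * Y.toRows₁.map c := by
        have := hY.wronskian_self
        rw [wronskian_eq_blocks, sub_eq_zero] at this
        rw [← Matrix.map_mul, ← Matrix.map_mul, this]
      rw [e1]
      simp only [D, D', Matrix.sub_mul, Matrix.mul_sub, Matrix.smul_mul, Matrix.mul_smul,
        Matrix.neg_mul, e2]
      match_scalars <;> simp
    have h3 := congrArg det hD
    rw [det_mul, h2, mul_zero, ← RingHom.mapMatrix_apply, ← RingHom.map_det] at h3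
    have h4 := hY.isUnit_det_gram.ne_zero
    exact h4 ((map_eq_zero c).mp h3.symm)
  refine (p.roots.toFinset.finite_toSet).subset fun lam h => ?_
  rw [Set.mem_ofPred_eq, IsGraph, isUnit_iff_ne_zero, not_not, ← hp] at h
  simpa [hp0] using h

theorem frameDen_vertE (lam : ℝ) : frameDen lam (vertE n) = -1 := by
  simp [frameDen, vertE]

theorem isGraph_vertE (lam : ℝ) : IsGraph lam (vertE n) := by
  rw [IsGraph, frameDen_vertE, det_neg, det_one, mul_one]
  exact (isUnit_one.neg).pow _

theorem graphMat_vertE (lam : ℝ) : graphMat lam (vertE n) = 0 := by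
  simp [graphMat, vertE]

/-- The comparative index in coordinates moved by a symplectic matrix. -/
theorem signedCompIndex_eq_graphMat {s lam : ℝ} (hs : s ≠ 0) {Z : Mat2 n} (hZ : IsSymplectic Z)
    {Y B : Mat21 n} (hY : IsLagrangian Y) (hB : IsLagrangian B)
    (h0 : IsGraph lam (Z * vertE n)) (h1 : IsGraph lam (Z * Y)) (h2 : IsGraph lam (Z * B)) :
    signedCompIndex s Y B =
      (negInertia (-s • (graphMat lam (Z * B) - graphMat lam (Z * vertE n))) : ℤ) +
        negInertia (-s • (graphMat lam (Z * Y) - graphMat lam (Z * B))) -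
        negInertia (-s • (graphMat lam (Z * Y) - graphMat lam (Z * vertE n))) := by
  have hE := hZ.mul_isLagrangian (isLagrangian_vertE (n := n))
  -- The upper block is itself a Wronskian, X = -W(E, Y) = -W(ZE, ZY), so it also becomes a
  -- difference of graph matrices in the moved frame.
  have hupper : ∀ {Y : Mat21 n}, IsGraph lam (Z * Y) → Y.toRows₁ =
      -(frameDen lam (Z * vertE n))ᵀ * (graphMat lam (Z * Y) - graphMat lam (Z * vertE n)) *
        frameDen lam (Z * Y) := by
    intro Y hY
    rw [Matrix.neg_mul, Matrix.neg_mul, ← wronskian_eq_graphMat hE h0 hY, hZ.wronskian_mul,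
      wronskian_vertE, neg_neg]
  have hsymm : ∀ {Y : Mat21 n}, IsLagrangian Y → IsGraph lam (Z * Y) →
      (graphMat lam (Z * Y) - graphMat lam (Z * vertE n))ᵀ =
        graphMat lam (Z * Y) - graphMat lam (Z * vertE n) := by
    intro Y hY h
    rw [transpose_sub, (hZ.mul_isLagrangian hY).graphMat_transpose h, hE.graphMat_transpose h0]
  have hL : IsUnit (-(frameDen lam (Z * vertE n))ᵀ).det := by
    rw [det_neg]
    exact (isUnit_one.neg.pow _).mul h0.isUnit_transpose
  have hW : wronskian Y B = (frameDen lam (Z * Y))ᵀ *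
      ((graphMat lam (Z * B) - graphMat lam (Z * vertE n)) -
        (graphMat lam (Z * Y) - graphMat lam (Z * vertE n))) * frameDen lam (Z * B) := by
    rw [sub_sub_sub_cancel_right, ← wronskian_eq_graphMat (hZ.mul_isLagrangian hY) h1 h2,
      hZ.wronskian_mul]
  rw [signedCompIndex_eq hs hL h1 h2 (hsymm hY h1) (hsymm hB h2) (hupper h1) (hupper h2) hW,
    sub_sub_sub_cancel_right]

/-- A symplectic matrix mapping the vertical plane to that of `(I; λ I)`. -/
noncomputable def tiltMat (n : ℕ) (lam : ℝ) : Mat2 n := fromBlocks 0 1 (-1) (lam • 1)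

theorem isSymplectic_tiltMat (lam : ℝ) : IsSymplectic (tiltMat n lam) := by
  rw [IsSymplectic, tiltMat, canJ, fromBlocks_transpose, fromBlocks_multiply, fromBlocks_multiply]
  simp

theorem tiltMat_mul_vertE (lam : ℝ) : tiltMat n lam * vertE n = fromRows 1 (lam • 1) := by
  rw [tiltMat, vertE, fromBlocks_mul_fromRows]
  simp

theorem wronskian_tiltMat (lam : ℝ) (Y : Mat21 n) :
    wronskian (tiltMat n lam * vertE n) Y = -frameDen lam Y := by
  rw [tiltMat_mul_vertE, wronskian_eq_blocks, frameDen]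
  simp

theorem rank_frameDen {lam : ℝ} {Y : Mat21 n} (h : IsGraph lam Y) : (frameDen lam Y).rank = n := by
  rw [rank_of_isUnit _ ((isUnit_iff_isUnit_det _).mpr h), Fintype.card_fin]

end GraphCoordinates

/-! ### Oscillation numbers through local increments -/

section OscillationNumbers

open Filter Topology

variable {n : ℕ}

theorem continuousAt_nonsing_inv {ι : Type*} [Fintype ι] [DecidableEq ι] {A : Matrix ι ι ℝ}
    (hA : IsUnit A.det) : ContinuousAt (fun B : Matrix ι ι ℝ => B⁻¹) A := by
  simp only [Matrix.inv_def, Ring.inverse_eq_inv']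
  have h1 : Continuous fun B : Matrix ι ι ℝ => B.det := continuous_id.matrix_det
  have h2 : Continuous fun B : Matrix ι ι ℝ => B.adjugate :=
    continuous_id.matrix_adjugate
  exact (h1.continuousAt.inv₀ hA.ne_zero).smul h2.continuousAt

theorem continuous_frameDen (lam : ℝ) : Continuous (frameDen lam : Mat21 n → _) := by
  have h1 : Continuous (toRows₁ : Mat21 n → Matrix (Fin n) (Fin n) ℝ) :=
    continuous_id.matrix_submatrix _ _
  have h2 : Continuous (toRows₂ : Mat21 n → Matrix (Fin n) (Fin n) ℝ) :=
    continuous_id.matrix_submatrix _ _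
  exact (h1.const_smul lam).sub h2

theorem isOpen_isGraph (lam : ℝ) : IsOpen {Y : Mat21 n | IsGraph lam Y} := by
  simp only [IsGraph, isUnit_iff_ne_zero]
  exact isOpen_ne.preimage (continuous_frameDen lam).matrix_det

theorem IsGraph.continuousAt_graphMat {lam : ℝ} {Y : Mat21 n} (h : IsGraph lam Y) :
    ContinuousAt (graphMat lam) Y := by
  have h1 : Continuous (toRows₁ : Mat21 n → Matrix (Fin n) (Fin n) ℝ) :=
    continuous_id.matrix_submatrix _ _
  have h2 : ContinuousAt (fun Y : Mat21 n => (frameDen lam Y)⁻¹) Y :=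
    ContinuousAt.comp (f := frameDen lam) (continuousAt_nonsing_inv h)
      (continuous_frameDen lam).continuousAt
  exact h1.continuousAt.mul h2

/-- The index whose decrements are the local contributions to the oscillation number. -/
noncomputable def crossingIndex (s lam : ℝ) (Z : Mat2 n) (Y : Mat21 n) : ℤ :=
  negInertia (-s • (graphMat lam (Z * Y) - graphMat lam (Z * vertE n)))

/-- The difference of the graph matrices is continuous and has the rank of the Wronskian, so its
index cannot jump while that rank is constant. -/
theorem eventually_negInertia_graphMat_sub_eq {T : Type*} [TopologicalSpace T] {S : Set T} {t₀ : T}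
    {Y₁ Y₂ : T → Mat21 n} {lam σ : ℝ} (hσ : σ ≠ 0) (hc₁ : ContinuousWithinAt Y₁ S t₀)
    (hc₂ : ContinuousWithinAt Y₂ S t₀) (ht₀ : t₀ ∈ S)
    (hL₁ : ∀ t ∈ S, IsLagrangian (Y₁ t)) (hL₂ : ∀ t ∈ S, IsLagrangian (Y₂ t))
    (hg₁ : IsGraph lam (Y₁ t₀)) (hg₂ : IsGraph lam (Y₂ t₀)) {r : ℕ}
    (hr : ∀ t ∈ S, (wronskian (Y₁ t) (Y₂ t)).rank = r) :
    ∀ᶠ t in 𝓝[S] t₀, negInertia (σ • (graphMat lam (Y₂ t) - graphMat lam (Y₁ t))) =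
      negInertia (σ • (graphMat lam (Y₂ t₀) - graphMat lam (Y₁ t₀))) := by
  have hl : Tendsto (fun t => σ • (graphMat lam (Y₂ t) - graphMat lam (Y₁ t))) (𝓝[S] t₀)
      (𝓝 (σ • (graphMat lam (Y₂ t₀) - graphMat lam (Y₁ t₀)))) :=
    ((hg₂.continuousAt_graphMat.tendsto.comp hc₂).sub
      (hg₁.continuousAt_graphMat.tendsto.comp hc₁)).const_smul σ
  have e₁ : ∀ᶠ t in 𝓝[S] t₀, IsGraph lam (Y₁ t) := hc₁ ((isOpen_isGraph lam).mem_nhds hg₁)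
  have e₂ : ∀ᶠ t in 𝓝[S] t₀, IsGraph lam (Y₂ t) := hc₂ ((isOpen_isGraph lam).mem_nhds hg₂)
  have hs : ∀ t ∈ S, IsGraph lam (Y₁ t) → IsGraph lam (Y₂ t) →
      (σ • (graphMat lam (Y₂ t) - graphMat lam (Y₁ t)))ᵀ =
        σ • (graphMat lam (Y₂ t) - graphMat lam (Y₁ t)) := by
    intro t ht h₁ h₂
    rw [transpose_smul, transpose_sub, (hL₁ t ht).graphMat_transpose h₁,
      (hL₂ t ht).graphMat_transpose h₂]
  have hrk : ∀ t ∈ S, IsGraph lam (Y₁ t) → IsGraph lam (Y₂ t) →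
      (σ • (graphMat lam (Y₂ t) - graphMat lam (Y₁ t))).rank = r := by
    intro t ht h₁ h₂
    rw [rank_smul_of_mem_nonZeroDivisors _ (mem_nonZeroDivisors_of_ne_zero hσ),
      rank_graphMat_sub (hL₁ t ht) h₁ h₂, hr t ht]
  refine eventually_negInertia_eq hl (hs t₀ ht₀ hg₁ hg₂) ?_ ?_
  · filter_upwards [e₁, e₂, self_mem_nhdsWithin] with t h₁ h₂ ht using hs t ht h₁ h₂
  · filter_upwards [e₁, e₂, self_mem_nhdsWithin] with t h₁ h₂ ht
    rw [hrk t ht h₁ h₂, hrk t₀ ht₀ hg₁ hg₂]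

/-- Where the ranks are constant, the comparative index changes as the crossing index. -/
theorem eventually_signedCompIndex_sub {T : Type*} [TopologicalSpace T] {S : Set T} {t₀ : T}
    {s : ℝ} (hs : s ≠ 0) {Z R : T → Mat2 n} {Y : T → Mat21 n} (ht₀ : t₀ ∈ S)
    (hZc : ContinuousWithinAt Z S t₀) (hRc : ContinuousWithinAt R S t₀)
    (hYc : ContinuousWithinAt Y S t₀) (hZ : ∀ t ∈ S, IsSymplectic (Z t))
    (hR : ∀ t ∈ S, IsSymplectic (R t)) (hY : ∀ t ∈ S, IsLagrangian (Y t)) {r₁ r₂ : ℕ}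
    (hr₁ : ∀ t ∈ S, (wronskian (R t * vertE n) (Y t)).rank = r₁)
    (hr₂ : ∀ t ∈ S, (R t * vertE n).toRows₁.rank = r₂) :
    ∃ F : Set ℝ, F.Finite ∧ ∀ lam ∉ F, ∀ᶠ t in 𝓝[S] t₀,
      signedCompIndex s (Y t) (R t * vertE n) - signedCompIndex s (Y t₀) (R t₀ * vertE n) =
        -(crossingIndex s lam (Z t) (Y t) - crossingIndex s lam (Z t₀) (Y t₀)) := by
  have hE : IsLagrangian (vertE n) := isLagrangian_vertE
  have hB : ∀ t ∈ S, IsLagrangian (R t * vertE n) := fun t ht => (hR t ht).mul_isLagrangian hE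
  have hZE : ∀ t ∈ S, IsLagrangian (Z t * vertE n) := fun t ht => (hZ t ht).mul_isLagrangian hE
  have hZY : ∀ t ∈ S, IsLagrangian (Z t * Y t) :=
    fun t ht => (hZ t ht).mul_isLagrangian (hY t ht)
  have hZB : ∀ t ∈ S, IsLagrangian (Z t * (R t * vertE n)) :=
    fun t ht => (hZ t ht).mul_isLagrangian (hB t ht)
  refine ⟨_, ((hZE t₀ ht₀).finite_not_isGraph.union (hZY t₀ ht₀).finite_not_isGraph).union
    (hZB t₀ ht₀).finite_not_isGraph, fun lam hlam => ?_⟩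
  simp only [Set.mem_union, Set.mem_ofPred_eq, not_or, not_not] at hlam
  obtain ⟨⟨g0, g1⟩, g2⟩ := hlam
  have c0 : ContinuousWithinAt (fun t => Z t * vertE n) S t₀ :=
    (continuous_id.matrix_mul continuous_const).continuousAt.comp_continuousWithinAt hZc
  have cB : ContinuousWithinAt (fun t => R t * vertE n) S t₀ :=
    (continuous_id.matrix_mul continuous_const).continuousAt.comp_continuousWithinAt hRc
  have cm : Continuous fun q : Mat2 n × Mat21 n => q.1 * q.2 :=
    continuous_fst.matrix_mul continuous_snd
  have c1 : ContinuousWithinAt (fun t => Z t * Y t) S t₀ :=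
    cm.continuousAt.comp_continuousWithinAt (hZc.prodMk hYc)
  have c2 : ContinuousWithinAt (fun t => Z t * (R t * vertE n)) S t₀ :=
    cm.continuousAt.comp_continuousWithinAt (hZc.prodMk cB)
  have e0 : ∀ᶠ t in 𝓝[S] t₀, IsGraph lam (Z t * vertE n) := c0 ((isOpen_isGraph lam).mem_nhds g0)
  have e1 : ∀ᶠ t in 𝓝[S] t₀, IsGraph lam (Z t * Y t) := c1 ((isOpen_isGraph lam).mem_nhds g1)
  have e2 : ∀ᶠ t in 𝓝[S] t₀, IsGraph lam (Z t * (R t * vertE n)) :=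
    c2 ((isOpen_isGraph lam).mem_nhds g2)
  -- Here W(ZE, ZRE) = W(E, RE) is minus the upper block of RE: this is where the second rank
  -- condition is used. The first one gives `k2`.
  have k1 := eventually_negInertia_graphMat_sub_eq (neg_ne_zero.mpr hs) c0 c2 ht₀ hZE hZB g0 g2
    (r := r₂) fun t ht => by
      rw [(hZ t ht).wronskian_mul, wronskian_vertE, ← hr₂ t ht, ← neg_one_smul ℝ,
        rank_smul_of_mem_nonZeroDivisors _ (mem_nonZeroDivisors_of_ne_zero (by norm_num))]
  have k2 := eventually_negInertia_graphMat_sub_eq (neg_ne_zero.mpr hs) c2 c1 ht₀ hZB hZY g2 g1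
    (r := r₁) fun t ht => by rw [(hZ t ht).wronskian_mul, hr₁ t ht]
  filter_upwards [e0, e1, e2, k1, k2, self_mem_nhdsWithin] with t h0 h1 h2 hk1 hk2 ht
  rw [signedCompIndex_eq_graphMat hs (hZ t ht) (hY t ht) (hB t ht) h0 h1 h2,
    signedCompIndex_eq_graphMat hs (hZ t₀ ht₀) (hY t₀ ht₀) (hB t₀ ht₀) g0 g1 g2, hk1, hk2,
    crossingIndex, crossingIndex]
  ring

/-- Both oscillation sums at once, up to sign: `s = 1` gives `𝒩`, `s = -1` gives `-𝒩*`. -/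
noncomputable def signedOscSum (s : ℝ) (Y : ℝ → Mat21 n) (p : ℕ) (t : ℕ → ℝ)
    (R : ℕ → ℝ → Mat2 n) : ℤ :=
  ∑ k ∈ Finset.range p, (signedCompIndex s (Y (t (k + 1))) (R k (t (k + 1)) * vertE n)
    - signedCompIndex s (Y (t k)) (R k (t k) * vertE n))

theorem signedOscSum_one (Y : ℝ → Mat21 n) (p : ℕ) (t : ℕ → ℝ) (R : ℕ → ℝ → Mat2 n) :
    signedOscSum 1 Y p t R = oscSum Y p t R := by
  simp only [signedOscSum, oscSum, signedCompIndex_one]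

theorem signedOscSum_neg_one (Y : ℝ → Mat21 n) (p : ℕ) (t : ℕ → ℝ) (R : ℕ → ℝ → Mat2 n) :
    signedOscSum (-1) Y p t R = -dualOscSum Y p t R := by
  simp only [signedOscSum, dualOscSum, signedCompIndex_neg_one, ← Finset.sum_neg_distrib, neg_sub]

/-- After clamping `u` to each piece, pieces to the left of `u` contribute their full increment and
pieces to the right contribute zero, so the sum telescopes. -/
theorem sum_clamp_sub (h : ℝ → ℤ) {t : ℕ → ℝ} {p : ℕ} (ht : ∀ k < p, t k < t (k + 1)) {u : ℝ}
    (hu : t 0 ≤ u) :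
    ∑ k ∈ Finset.range p, (h (max (t k) (min u (t (k + 1)))) - h (t k)) =
      h (min u (t p)) - h (t 0) := by
  induction p with
  | zero => simp [hu]
  | succ p ih =>
    rw [Finset.sum_range_succ, ih fun k hk => ht k (by omega)]
    have hp := ht p (by omega)
    rcases le_total u (t p) with hup | hup
    · rw [min_eq_left hup, min_eq_left (hup.trans hp.le), max_eq_left hup]
      ring
    · rw [min_eq_right hup, max_eq_right (le_min hup hp.le)]
      ring

theorem partition_le {t : ℕ → ℝ} {p : ℕ} (ht : ∀ k < p, t k < t (k + 1)) {i j : ℕ} (hij : i ≤ j)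
    (hj : j ≤ p) : t i ≤ t j := by
  induction j, hij using Nat.le_induction with
  | base => exact le_rfl
  | succ j _ ih => exact (ih (by omega)).trans (ht j (by omega)).le

/-- An oscillation sum is the total increment of a function whose local increments are those of
the crossing index in any symplectic frame. -/
theorem IsAdmissible.exists_primitive {a b : ℝ} {Y : ℝ → Mat21 n} {p : ℕ} {t : ℕ → ℝ}
    {R : ℕ → ℝ → Mat2 n} (hA : IsAdmissible a b Y p t R) (hY : IsLagrangianPath a b Y)
    {Z : ℝ → Mat2 n} (hZ : IsSymplecticPath a b Z) {s : ℝ} (hs : s ≠ 0) :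
    ∃ Φ : ℝ → ℤ, Φ b - Φ a = signedOscSum s Y p t R ∧ ∀ u₀ ∈ Set.Icc a b,
      ∃ F : Set ℝ, F.Finite ∧ ∀ lam ∉ F, ∀ᶠ u in 𝓝[Set.Icc a b] u₀,
        Φ u - Φ u₀ = -(crossingIndex s lam (Z u) (Y u) - crossingIndex s lam (Z u₀) (Y u₀)) := by
  let g : ℕ → ℝ → ℤ := fun k u => signedCompIndex s (Y u) (R k u * vertE n)
  let c : ℕ → ℝ → ℝ := fun k u => max (t k) (min u (t (k + 1)))
  have hcc : ∀ k, Continuous (c k) := fun k => by fun_prop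
  have hcm : ∀ k < p, ∀ u, c k u ∈ Set.Icc (t k) (t (k + 1)) := fun k hk u =>
    ⟨le_max_left _ _, max_le (hA.lt k hk).le (min_le_right _ _)⟩
  have hsub : ∀ k < p, Set.Icc (t k) (t (k + 1)) ⊆ Set.Icc a b := by
    intro k hk
    rw [← hA.left, ← hA.right]
    exact Set.Icc_subset_Icc (partition_le hA.lt (by omega) hk.le)
      (partition_le hA.lt (by omega) le_rfl)
  -- Φ sums the comparative indices at `u` clamped to each piece. This avoids choosing a piece at
  -- the partition points, where the indices for neighbouring `R k` may disagree.
  refine ⟨fun u => ∑ k ∈ Finset.range p, g k (c k u), ?_, fun u₀ hu₀ => ?_⟩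
  · rw [← Finset.sum_sub_distrib, signedOscSum]
    refine Finset.sum_congr rfl fun k hk => ?_
    have hk' := Finset.mem_range.mp hk
    have hlt := hA.lt k hk'
    have h1 : c k b = t (k + 1) := by
      have : t (k + 1) ≤ b := hA.right ▸ partition_le hA.lt hk' le_rfl
      simp only [c, min_eq_right this, max_eq_right hlt.le]
    have h2 : c k a = t k := by
      have : a ≤ t k := hA.left ▸ partition_le hA.lt (Nat.zero_le k) hk'.le
      simp only [c, min_eq_left (this.trans hlt.le), max_eq_left this]
    rw [h1, h2]
  -- For `k ≥ p` the claim is vacuous and the set empty, so that `choose` applies to all `k`.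
  · have hloc : ∀ k, ∃ F : Set ℝ, F.Finite ∧ (k < p → ∀ lam ∉ F,
        ∀ᶠ v in 𝓝[Set.Icc (t k) (t (k + 1))] (c k u₀), g k v - g k (c k u₀) =
          -(crossingIndex s lam (Z v) (Y v)
            - crossingIndex s lam (Z (c k u₀)) (Y (c k u₀)))) := by
      intro k
      by_cases hk : k < p
      · obtain ⟨r₁, hr₁⟩ := hA.rank_wronskian k hk
        obtain ⟨r₂, hr₂⟩ := hA.rank_upper k hk
        have hm := hcm k hk u₀
        obtain ⟨F, hF, h⟩ := eventually_signedCompIndex_sub hs hm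
          ((hZ.1.mono (hsub k hk)) _ hm) ((hA.symplectic k hk).1 _ hm)
          ((hY.1.mono (hsub k hk)) _ hm) (fun v hv => hZ.2 v (hsub k hk hv))
          (hA.symplectic k hk).2 (fun v hv => hY.2 v (hsub k hk hv)) hr₁ hr₂
        exact ⟨F, hF, fun _ => h⟩
      · exact ⟨∅, Set.finite_empty, fun h => absurd h hk⟩
    choose F hF hloc using hloc
    refine ⟨⋃ k ∈ Finset.range p, F k, (Finset.range p).finite_toSet.biUnion fun k _ => hF k,
      fun lam hlam => ?_⟩
    simp only [Set.mem_iUnion, not_exists] at hlam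
    have hev : ∀ᶠ u in 𝓝[Set.Icc a b] u₀, ∀ k ∈ Finset.range p, g k (c k u) - g k (c k u₀) =
        -(crossingIndex s lam (Z (c k u)) (Y (c k u))
          - crossingIndex s lam (Z (c k u₀)) (Y (c k u₀))) := by
      rw [Filter.eventually_all_finset]
      intro k hk
      have hk' := Finset.mem_range.mp hk
      -- Clamping is continuous with values in the closed piece, so the one-sided information at an
      -- endpoint suffices.
      have ht : Tendsto (c k) (𝓝[Set.Icc a b] u₀) (𝓝[Set.Icc (t k) (t (k + 1))] (c k u₀)) :=
        tendsto_nhdsWithin_iff.mpr ⟨(hcc k).continuousAt.tendsto.mono_left nhdsWithin_le_nhds,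
          Eventually.of_forall fun u => hcm k hk' u⟩
      exact ht.eventually (hloc k hk' lam (hlam k hk))
    have htel : ∀ u ∈ Set.Icc a b, ∑ k ∈ Finset.range p,
        (crossingIndex s lam (Z (c k u)) (Y (c k u)) -
          crossingIndex s lam (Z (t k)) (Y (t k))) =
        crossingIndex s lam (Z u) (Y u) - crossingIndex s lam (Z a) (Y a) := by
      intro u hu
      have := sum_clamp_sub (fun v => crossingIndex s lam (Z v) (Y v)) hA.lt
        (hA.left.trans_le hu.1)
      rwa [hA.right, hA.left, min_eq_left hu.2] at this
    filter_upwards [hev, self_mem_nhdsWithin] with u hu hmem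
    have h1 := htel u hmem
    have h2 := htel u₀ hu₀
    rw [Finset.sum_sub_distrib] at h1 h2
    rw [← Finset.sum_sub_distrib, Finset.sum_congr rfl hu, Finset.sum_neg_distrib,
      Finset.sum_sub_distrib]
    linarith

theorem eq_of_locally_constant {a b : ℝ} (hab : a ≤ b) {D : ℝ → ℤ}
    (h : ∀ u₀ ∈ Set.Icc a b, ∀ᶠ u in 𝓝[Set.Icc a b] u₀, D u = D u₀) : D b = D a := by
  refine isPreconnected_Icc.constant (s := Set.Icc a b) (fun u hu => ?_)
    (Set.right_mem_Icc.mpr hab) (Set.left_mem_Icc.mpr hab)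
  exact tendsto_nhds_of_eventually_eq (h u hu)

theorem isSymplecticPath_one (a b : ℝ) : IsSymplecticPath a b (fun _ => (1 : Mat2 n)) :=
  ⟨continuousOn_const, fun _ _ => by simp [IsSymplectic]⟩

/-- Both primitives change locally like the same crossing index, for a common λ outside two finite
sets, so they differ by a constant. -/
theorem signedOscSum_unique {a b : ℝ} (hab : a ≤ b) {Y : ℝ → Mat21 n}
    (hY : IsLagrangianPath a b Y) {s : ℝ} (hs : s ≠ 0) {p p' : ℕ} {t t' : ℕ → ℝ}
    {R R' : ℕ → ℝ → Mat2 n} (h : IsAdmissible a b Y p t R) (h' : IsAdmissible a b Y p' t' R') :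
    signedOscSum s Y p t R = signedOscSum s Y p' t' R' := by
  obtain ⟨Φ, hΦ, hl⟩ := h.exists_primitive hY (isSymplecticPath_one a b) hs
  obtain ⟨Φ', hΦ', hl'⟩ := h'.exists_primitive hY (isSymplecticPath_one a b) hs
  have := eq_of_locally_constant hab (D := fun u => Φ u - Φ' u) fun u₀ hu₀ => by
    obtain ⟨F, hF, k⟩ := hl u₀ hu₀
    obtain ⟨F', hF', k'⟩ := hl' u₀ hu₀
    obtain ⟨lam, hlam⟩ := (hF.union hF').infinite_compl.nonempty
    simp only [Set.mem_compl_iff, Set.mem_union, not_or] at hlam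
    filter_upwards [k lam hlam.1, k' lam hlam.2] with u e e'
    linarith
  linarith

/-- Each plane of the path is transversal to that of (I; λI) for some λ, and this persists nearby. A
mesh below the Lebesgue number of this cover allows one λ per piece; the constant `tiltMat` then has
Wronskian rank n and upper block I. -/
theorem exists_isAdmissible {a b : ℝ} (hab : a ≤ b) {Y : ℝ → Mat21 n}
    (hY : IsLagrangianPath a b Y) : ∃ p t R, IsAdmissible a b Y p t R := by
  rcases hab.eq_or_lt with rfl | hlt
  -- A partition with strict steps of a one-point interval has no pieces.
  · exact ⟨0, fun _ => a, fun _ _ => 1, rfl, rfl, by simp, by simp, by simp, by simp⟩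
  have hopen : ∀ lam : ℝ, ∃ O : Set ℝ, IsOpen O ∧
      Y ⁻¹' {Y | IsGraph lam Y} ∩ Set.Icc a b = O ∩ Set.Icc a b :=
    fun lam => continuousOn_iff'.mp hY.1 _ (isOpen_isGraph lam)
  choose O hO hYO using hopen
  have hcover : Set.Icc a b ⊆ ⋃ lam, O lam := by
    intro u hu
    obtain ⟨lam, hlam⟩ := (hY.2 u hu).finite_not_isGraph.infinite_compl.nonempty
    have hm : u ∈ Y ⁻¹' {Y | IsGraph lam Y} ∩ Set.Icc a b := ⟨not_not.mp hlam, hu⟩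
    rw [hYO] at hm
    exact Set.mem_iUnion.mpr ⟨lam, hm.1⟩
  obtain ⟨δ, hδ, hball⟩ := lebesgue_number_lemma_of_metric isCompact_Icc hO hcover
  obtain ⟨p, hp⟩ := exists_nat_gt ((b - a) / δ)
  have hba : 0 < b - a := sub_pos.mpr hlt
  have hp0 : (0 : ℝ) < p := (div_pos hba hδ).trans hp
  set w := (b - a) / p with hw
  have hw0 : 0 < w := div_pos hba hp0
  have hwδ : w < δ := by
    rw [div_lt_iff₀ hδ] at hp
    rw [hw, div_lt_iff₀ hp0]
    linarith
  have hwp : p * w = b - a := by rw [hw]; field_simp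
  let t : ℕ → ℝ := fun k => a + k * w
  have ht1 : ∀ k, t (k + 1) = t k + w := fun k => by simp only [t]; push_cast; ring
  have hsub : ∀ k < p, Set.Icc (t k) (t (k + 1)) ⊆ Set.Icc a b := by
    intro k hk
    refine Set.Icc_subset_Icc ?_ ?_
    · have : 0 ≤ (k : ℝ) * w := by positivity
      simp only [t]; linarith
    · have h1 : ((k + 1 : ℕ) : ℝ) ≤ p := by exact_mod_cast hk
      have := mul_le_mul_of_nonneg_right h1 hw0.le
      simp only [t]; linarith
  have hlam : ∀ k, ∃ lam, k < p → ∀ u ∈ Set.Icc (t k) (t (k + 1)), IsGraph lam (Y u) := by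
    intro k
    by_cases hk : k < p
    · have hmem : t k ∈ Set.Icc (t k) (t (k + 1)) :=
        Set.left_mem_Icc.mpr (by rw [ht1]; linarith)
      obtain ⟨lam, hl⟩ := hball (t k) (hsub k hk hmem)
      refine ⟨lam, fun _ u hu => ?_⟩
      have huO : u ∈ O lam := hl (by
        rw [ht1] at hu
        rw [Metric.mem_ball, Real.dist_eq, abs_of_nonneg (by linarith [hu.1])]
        linarith [hu.2])
      have : u ∈ O lam ∩ Set.Icc a b := ⟨huO, hsub k hk hu⟩
      rw [← hYO] at this
      exact this.1
    · exact ⟨0, fun h => absurd h hk⟩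
  choose lam hlam using hlam
  refine ⟨p, t, fun k _ => tiltMat n (lam k), ?_, ?_, ?_, ?_, ?_, ?_⟩
  · simp [t]
  · simp only [t, hwp]; ring
  · intro k _; rw [ht1]; linarith
  · exact fun k _ => ⟨continuousOn_const, fun _ _ => isSymplectic_tiltMat _⟩
  · refine fun k hk => ⟨n, fun u hu => ?_⟩
    rw [wronskian_tiltMat, ← neg_one_smul ℝ,
      rank_smul_of_mem_nonZeroDivisors _ (mem_nonZeroDivisors_of_ne_zero (by norm_num)),
      rank_frameDen (hlam k hk u hu)]
  · exact fun k _ => ⟨_, fun _ _ => rfl⟩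

theorem existsUnique_oscValue {a b : ℝ} (hab : a ≤ b) {Y : ℝ → Mat21 n}
    (hY : IsLagrangianPath a b Y) : ∃! z, IsOscValue a b Y z := by
  obtain ⟨p, t, R, h⟩ := exists_isAdmissible hab hY
  refine ⟨_, ⟨p, t, R, h, rfl⟩, ?_⟩
  rintro _ ⟨p', t', R', h', rfl⟩
  simpa only [signedOscSum_one] using signedOscSum_unique hab hY one_ne_zero h' h

theorem existsUnique_dualOscValue {a b : ℝ} (hab : a ≤ b) {Y : ℝ → Mat21 n}
    (hY : IsLagrangianPath a b Y) : ∃! z, IsDualOscValue a b Y z := by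
  obtain ⟨p, t, R, h⟩ := exists_isAdmissible hab hY
  refine ⟨_, ⟨p, t, R, h, rfl⟩, ?_⟩
  rintro _ ⟨p', t', R', h', rfl⟩
  simpa only [signedOscSum_neg_one, neg_inj] using
    signedOscSum_unique hab hY (neg_ne_zero.mpr one_ne_zero) h' h

theorem IsLagrangianPath.oscWellDefined {a b : ℝ} {Y : ℝ → Mat21 n}
    (hY : IsLagrangianPath a b Y) (hab : a ≤ b) : OscWellDefined a b Y :=
  ⟨existsUnique_oscValue hab hY, existsUnique_dualOscValue hab hY⟩

theorem OscWellDefined.isOscValue {a b : ℝ} {Y : ℝ → Mat21 n} (h : OscWellDefined a b Y) :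
    IsOscValue a b Y (oscNumber a b Y) := by
  rw [oscNumber, dif_pos h.1.exists]
  exact Classical.choose_spec h.1.exists

theorem OscWellDefined.isDualOscValue {a b : ℝ} {Y : ℝ → Mat21 n} (h : OscWellDefined a b Y) :
    IsDualOscValue a b Y (dualOscNumber a b Y) := by
  rw [dualOscNumber, dif_pos h.2.exists]
  exact Classical.choose_spec h.2.exists

theorem IsLagrangianPath.inv_mul {a b : ℝ} {Y : ℝ → Mat21 n} (hY : IsLagrangianPath a b Y)
    {Z : ℝ → Mat2 n} (hZ : IsSymplecticPath a b Z) :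
    IsLagrangianPath a b (fun t => (Z t)⁻¹ * Y t) := by
  refine ⟨fun t ht => ?_, fun t ht => (hZ.2 t ht).inv.mul_isLagrangian (hY.2 t ht)⟩
  have cm : Continuous fun q : Mat2 n × Mat21 n => q.1 * q.2 :=
    continuous_fst.matrix_mul continuous_snd
  exact cm.continuousAt.comp_continuousWithinAt
    (((continuousAt_nonsing_inv (hZ.2 t ht).isUnit_det).comp_continuousWithinAt (hZ.1 t ht)).prodMk
      (hY.1 t ht))

/-! ### The comparison formula -/

/-- The comparison formula for the sums over arbitrary admissible partitions. -/
theorem signedOscSum_comparison {a b : ℝ} (hab : a ≤ b) {Y Yh : ℝ → Mat21 n}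
    (hY : IsLagrangianPath a b Y) (hYh : IsLagrangianPath a b Yh) {Z : ℝ → Mat2 n}
    (hZ : IsSymplecticPath a b Z) {K : ℝ → Matrix (Fin n) (Fin n) ℝ}
    (hK : ∀ t ∈ Set.Icc a b, IsUnit (K t).det)
    (hZK : ∀ t ∈ Set.Icc a b, Z t * vertE n = Yh t * K t) {s : ℝ} (hs : s ≠ 0)
    {p₁ p₂ p₃ : ℕ} {t₁ t₂ t₃ : ℕ → ℝ} {R₁ R₂ R₃ : ℕ → ℝ → Mat2 n}
    (h₁ : IsAdmissible a b Y p₁ t₁ R₁) (h₂ : IsAdmissible a b Yh p₂ t₂ R₂)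
    (h₃ : IsAdmissible a b (fun t => (Z t)⁻¹ * Y t) p₃ t₃ R₃) :
    signedOscSum s Y p₁ t₁ R₁ - signedOscSum s Yh p₂ t₂ R₂ =
      signedCompIndex s (Y b) (Yh b) - signedCompIndex s (Y a) (Yh a) +
        signedOscSum s (fun t => (Z t)⁻¹ * Y t) p₃ t₃ R₃ := by
  have hI : IsSymplecticPath a b (fun _ => (1 : Mat2 n)) := isSymplecticPath_one a b
  obtain ⟨Φ₁, e₁, l₁⟩ := h₁.exists_primitive hY hI hs
  obtain ⟨Φ₂, e₂, l₂⟩ := h₂.exists_primitive hYh hI hs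
  obtain ⟨Φ₃, e₃, l₃⟩ := h₃.exists_primitive (hY.inv_mul hZ) hZ hs
  have hone : ∀ (lam : ℝ) (W : Mat21 n),
      crossingIndex s lam 1 W = negInertia (-s • graphMat lam W) := by
    intro lam W
    rw [crossingIndex, Matrix.one_mul, Matrix.one_mul, graphMat_vertE, sub_zero]
  -- In the frame `Z` the pair (Z⁻¹Y, E) becomes (Y, ŶK), and `K` disappears because the graph
  -- matrix depends only on the plane.
  have hZZ : ∀ t ∈ Set.Icc a b, ∀ lam : ℝ, crossingIndex s lam (Z t) ((Z t)⁻¹ * Y t) =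
      negInertia (-s • (graphMat lam (Y t) - graphMat lam (Yh t))) := by
    intro t ht lam
    rw [crossingIndex, mul_nonsing_inv_cancel_left _ _ (hZ.2 t ht).isUnit_det, hZK t ht,
      graphMat_mul_right _ _ (hK t ht)]
  have hcomp : ∀ t ∈ Set.Icc a b, ∀ lam : ℝ, IsGraph lam (Y t) → IsGraph lam (Yh t) →
      signedCompIndex s (Y t) (Yh t) = (negInertia (-s • graphMat lam (Yh t)) : ℤ) +
        negInertia (-s • (graphMat lam (Y t) - graphMat lam (Yh t))) -
        negInertia (-s • graphMat lam (Y t)) := by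
    intro t ht lam g gh
    have := signedCompIndex_eq_graphMat (lam := lam) hs (hI.2 t ht) (hY.2 t ht) (hYh.2 t ht)
    simp only [Matrix.one_mul, graphMat_vertE, sub_zero] at this
    exact this (isGraph_vertE lam) g gh
  -- One λ must serve the three primitives and be transversal to Y and Ŷ at `u₀`; only finitely many
  -- values are excluded. The three crossing indices then cancel against the coboundary.
  have := eq_of_locally_constant hab
    (D := fun u => Φ₁ u - Φ₂ u - signedCompIndex s (Y u) (Yh u) - Φ₃ u) fun u₀ hu₀ => by
      obtain ⟨F₁, f₁, k₁⟩ := l₁ u₀ hu₀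
      obtain ⟨F₂, f₂, k₂⟩ := l₂ u₀ hu₀
      obtain ⟨F₃, f₃, k₃⟩ := l₃ u₀ hu₀
      obtain ⟨lam, hlam⟩ := ((((f₁.union f₂).union f₃).union
        (hY.2 u₀ hu₀).finite_not_isGraph).union
          (hYh.2 u₀ hu₀).finite_not_isGraph).infinite_compl.nonempty
      simp only [Set.mem_compl_iff, Set.mem_union, not_or, Set.mem_ofPred_eq, not_not] at hlam
      obtain ⟨⟨⟨⟨m₁, m₂⟩, m₃⟩, g⟩, gh⟩ := hlam
      filter_upwards [k₁ lam m₁, k₂ lam m₂, k₃ lam m₃, self_mem_nhdsWithin,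
        hY.1 u₀ hu₀ ((isOpen_isGraph lam).mem_nhds g),
        hYh.1 u₀ hu₀ ((isOpen_isGraph lam).mem_nhds gh)] with u r₁ r₂ r₃ hu gu ghu
      rw [hone, hone] at r₁ r₂
      rw [hZZ u hu, hZZ u₀ hu₀] at r₃
      rw [hcomp u hu lam gu ghu, hcomp u₀ hu₀ lam g gh]
      linarith
  linarith

theorem oscNumber_comparison {a b : ℝ} (hab : a ≤ b) {Y Yh : ℝ → Mat21 n}
    (hY : IsLagrangianPath a b Y) (hYh : IsLagrangianPath a b Yh) {Z : ℝ → Mat2 n}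
    (hZ : IsSymplecticPath a b Z) {K : ℝ → Matrix (Fin n) (Fin n) ℝ}
    (hK : ∀ t ∈ Set.Icc a b, IsUnit (K t).det)
    (hZK : ∀ t ∈ Set.Icc a b, Z t * vertE n = Yh t * K t) :
    OscWellDefined a b (fun t => (Z t)⁻¹ * Y t) ∧
    oscNumber a b Y - oscNumber a b Yh =
      compIndex (Y b) (Yh b) - compIndex (Y a) (Yh a) +
        oscNumber a b (fun t => (Z t)⁻¹ * Y t) ∧
    dualOscNumber a b Y - dualOscNumber a b Yh =
      dualCompIndex (Y a) (Yh a) - dualCompIndex (Y b) (Yh b) +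
        dualOscNumber a b (fun t => (Z t)⁻¹ * Y t) := by
  have w₁ := hY.oscWellDefined hab
  have w₂ := hYh.oscWellDefined hab
  have w₃ := (hY.inv_mul hZ).oscWellDefined hab
  refine ⟨w₃, ?_, ?_⟩
  · obtain ⟨p₁, t₁, R₁, h₁, e₁⟩ := w₁.isOscValue
    obtain ⟨p₂, t₂, R₂, h₂, e₂⟩ := w₂.isOscValue
    obtain ⟨p₃, t₃, R₃, h₃, e₃⟩ := w₃.isOscValue
    have := signedOscSum_comparison hab hY hYh hZ hK hZK one_ne_zero h₁ h₂ h₃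
    simpa only [signedOscSum_one, signedCompIndex_one, e₁, e₂, e₃] using this
  · obtain ⟨p₁, t₁, R₁, h₁, e₁⟩ := w₁.isDualOscValue
    obtain ⟨p₂, t₂, R₂, h₂, e₂⟩ := w₂.isDualOscValue
    obtain ⟨p₃, t₃, R₃, h₃, e₃⟩ := w₃.isDualOscValue
    have := signedOscSum_comparison hab hY hYh hZ hK hZK (neg_ne_zero.mpr one_ne_zero) h₁ h₂ h₃
    simp only [signedOscSum_neg_one, signedCompIndex_neg_one, e₁, e₂, e₃] at this
    linarith

end OscillationNumbers

/-! ### The frame Z_Y is symplectic and continuous -/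

section SymplecticFrame

variable {n : ℕ}

theorem IsLagrangian.posDef_gram {Y : Mat21 n} (hY : IsLagrangian Y) : (Yᵀ * Y).PosDef := by
  have h1 : (Yᴴ * Y).PosSemidef := posSemidef_conjTranspose_mul_self Y
  rw [conjTranspose_eq_transpose_of_trivial] at h1
  exact h1.posDef_iff_isUnit.mpr ((isUnit_iff_isUnit_det _).mpr hY.isUnit_det_gram)

theorem isSelfAdjoint_gram (Y : Mat21 n) : IsSelfAdjoint (Yᵀ * Y) := by
  rw [isSelfAdjoint_iff, star_eq_conjTranspose, conjTranspose_eq_transpose_of_trivial]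
  simp

theorem IsLagrangian.spectrum_gram_pos {Y : Mat21 n} (hY : IsLagrangian Y) :
    ∀ x ∈ spectrum ℝ (Yᵀ * Y), 0 < x := by
  intro x hx
  have hp := hY.posDef_gram
  rw [hp.isHermitian.spectrum_real_eq_range_eigenvalues] at hx
  obtain ⟨i, rfl⟩ := hx
  exact hp.eigenvalues_pos i

theorem continuousOn_rpow_neg_half :
    ContinuousOn (fun x : ℝ => x ^ (-(1 / 2) : ℝ)) (Set.Ioi 0) :=
  fun x hx => (Real.continuousAt_rpow_const x _ (Or.inl (ne_of_gt hx))).continuousWithinAt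

theorem normK_transpose (Y : Mat21 n) : (normK Y)ᵀ = normK Y := by
  have h : IsSelfAdjoint (normK Y) := cfc_predicate _ _
  rwa [isSelfAdjoint_iff, star_eq_conjTranspose, conjTranspose_eq_transpose_of_trivial] at h

theorem IsLagrangian.normK_mul_gram_mul_normK {Y : Mat21 n} (hY : IsLagrangian Y) :
    normK Y * (Yᵀ * Y) * normK Y = 1 := by
  have hsa := isSelfAdjoint_gram Y
  have hc : ContinuousOn (fun x : ℝ => x ^ (-(1 / 2) : ℝ)) (spectrum ℝ (Yᵀ * Y)) :=
    continuousOn_rpow_neg_half.mono fun x hx => hY.spectrum_gram_pos x hx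
  have h1 : normK Y * (Yᵀ * Y) * normK Y =
      cfc (fun x : ℝ => x ^ (-(1 / 2) : ℝ) * x * x ^ (-(1 / 2) : ℝ)) (Yᵀ * Y) := by
    rw [cfc_mul (fun x : ℝ => x ^ (-(1 / 2) : ℝ) * x) (fun x : ℝ => x ^ (-(1 / 2) : ℝ)) _
      (hc.mul continuousOn_id) hc, cfc_mul (fun x : ℝ => x ^ (-(1 / 2) : ℝ)) (fun x => x) _ hc
      continuousOn_id, cfc_id' ℝ _]
    rfl
  rw [h1, cfc_congr (g := fun _ => (1 : ℝ)), cfc_const_one ℝ _]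
  intro x hx
  have hx0 := hY.spectrum_gram_pos x hx
  change x ^ (-(1 / 2) : ℝ) * x * x ^ (-(1 / 2) : ℝ) = 1
  rw [mul_right_comm, ← Real.rpow_add hx0, ← Real.rpow_add_one hx0.ne']
  norm_num

theorem IsLagrangian.isUnit_det_normK {Y : Mat21 n} (hY : IsLagrangian Y) :
    IsUnit (normK Y).det :=
  isUnit_det_of_left_inverse hY.normK_mul_gram_mul_normK

theorem matZ_mul_vertE (Y : Mat21 n) : matZ Y * vertE n = Y * normK Y := by
  rw [matZ, vertE, fromCols_mul_fromRows]
  simp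

theorem canJ_transpose_mul : (canJ n)ᵀ * canJ n = 1 := by
  rw [canJ, fromBlocks_transpose, fromBlocks_multiply, ← fromBlocks_one]
  simp

/-- In ZᵀJZ the diagonal blocks vanish because YᵀJY = 0, and the off-diagonal blocks are ±K(YᵀY)K =
±I. -/
theorem IsLagrangian.isSymplectic_matZ {Y : Mat21 n} (hY : IsLagrangian Y) :
    IsSymplectic (matZ Y) := by
  have hJt : (canJ n)ᵀ = -canJ n := by
    rw [canJ, fromBlocks_transpose, fromBlocks_neg]; simp
  have hJJ : canJ n * canJ n = -1 := by
    rw [← neg_inj, ← Matrix.neg_mul, ← hJt, canJ_transpose_mul, neg_neg]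
  have hK := hY.normK_mul_gram_mul_normK
  have h0 : Yᵀ * canJ n * Y = 0 := hY.1
  have hA : ∀ M : Matrix (Fin n) (Fin n) ℝ, Yᵀ * (canJ n * (Y * M)) = 0 := fun M => by
    rw [← Matrix.mul_assoc, ← Matrix.mul_assoc, h0, Matrix.zero_mul]
  have hB : ∀ M : Mat21 n, canJ n * (canJ n * M) = -M := fun M => by
    rw [← Matrix.mul_assoc, hJJ, Matrix.neg_mul, Matrix.one_mul]
  simp only [Matrix.mul_assoc] at hK
  rw [IsSymplectic, matZ, transpose_fromCols, fromRows_mul, fromRows_mul_fromCols]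
  simp only [transpose_mul, normK_transpose, hJt, Matrix.mul_assoc, Matrix.neg_mul, Matrix.mul_neg,
    hA, hB, neg_zero, Matrix.mul_zero, hK, neg_neg]
  rfl

-- After unitary diagonalisation the operator norm of g(A) is the largest |g| at an eigenvalue,
-- which is the sup norm of g on the spectrum. The isometry serves to prove that f(A) is continuous
-- in A.
open scoped Matrix.Norms.L2Operator in
theorem isometricContinuousFunctionalCalculus_matrix (n : ℕ) :
    IsometricContinuousFunctionalCalculus ℝ (Matrix (Fin n) (Fin n) ℝ) IsSelfAdjoint where
  toContinuousFunctionalCalculus := inferInstance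
  isometric A hA := by
    have hH : A.IsHermitian := hA
    refine AddMonoidHomClass.isometry_of_norm _ fun g => ?_
    have h1 : cfcHom hA g = hH.cfcAux g := by rw [← hH.cfcHom_eq_cfcAux]
    rw [h1, IsHermitian.cfcAux_apply, Unitary.conjStarAlgAut_apply, ← Unitary.coe_star,
      CStarRing.norm_mul_coe_unitary, CStarRing.norm_coe_unitary_mul, l2_opNorm_diagonal]
    apply le_antisymm
    · refine (pi_norm_le_iff_of_nonneg (norm_nonneg _)).mpr fun i => ?_
      exact g.norm_coe_le_norm _
    · refine (ContinuousMap.norm_le _ (norm_nonneg _)).mpr fun x => ?_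
      obtain ⟨x, hx⟩ := x
      obtain ⟨i, rfl⟩ := hH.spectrum_real_eq_range_eigenvalues ▸ hx
      exact norm_le_pi_norm (RCLike.ofReal ∘ g ∘ fun i ↦
        (⟨hH.eigenvalues i, hH.eigenvalues_mem_spectrum_real i⟩ : spectrum ℝ A)) i

/-- The operator norm enters only inside the proof, since it induces the entrywise topology. An open
`U` containing the spectra is needed as x^(-1/2) is continuous only away from 0. -/
theorem continuousOn_cfc_of_spectrum_subset {n : ℕ} {T : Type*} [TopologicalSpace T] {S : Set T}
    {U : Set ℝ} (hU : IsOpen U) {f : ℝ → ℝ} (hf : ContinuousOn f U)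
    {A : T → Matrix (Fin n) (Fin n) ℝ} (hA : ContinuousOn A S) (hs : ∀ t ∈ S, IsSelfAdjoint (A t))
    (hAU : ∀ t ∈ S, spectrum ℝ (A t) ⊆ U) : ContinuousOn (fun t => cfc f (A t)) S := by
  open scoped Matrix.Norms.L2Operator in
  have _ := isometricContinuousFunctionalCalculus_matrix n
  have _ : CompleteSpace (Matrix (Fin n) (Fin n) ℝ) := FiniteDimensional.complete ℝ _
  refine ContinuousOn.cfc_of_mem_nhdsSet (s := U) _ ?_ hA hs hf
  rw [hU.mem_nhdsSet]
  exact Set.iUnion₂_subset hAU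

theorem continuousOn_normK {a b : ℝ} {Y : ℝ → Mat21 n} (hY : IsLagrangianPath a b Y) :
    ContinuousOn (fun t => normK (Y t)) (Set.Icc a b) := by
  have cg : Continuous fun Y : Mat21 n => Yᵀ * Y :=
    continuous_id.matrix_transpose.matrix_mul continuous_id
  exact continuousOn_cfc_of_spectrum_subset isOpen_Ioi continuousOn_rpow_neg_half
    (cg.comp_continuousOn hY.1) (fun t _ => isSelfAdjoint_gram (Y t))
    fun t ht => (hY.2 t ht).spectrum_gram_pos

theorem isSymplecticPath_matZ {a b : ℝ} {Y : ℝ → Mat21 n} (hY : IsLagrangianPath a b Y) :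
    IsSymplecticPath a b (fun t => matZ (Y t)) := by
  refine ⟨?_, fun t ht => (hY.2 t ht).isSymplectic_matZ⟩
  have hm : Continuous fun q : Mat21 n × Matrix (Fin n) (Fin n) ℝ => q.1 * q.2 :=
    continuous_fst.matrix_mul continuous_snd
  have h1 : ContinuousOn (fun t => Y t * normK (Y t)) (Set.Icc a b) :=
    hm.comp_continuousOn (hY.1.prodMk (continuousOn_normK hY))
  have hJ : Continuous fun M : Mat21 n => fromCols (canJ n * M) M := by
    refine continuous_matrix fun i j => ?_
    rcases j with j | j
    · exact (continuous_const.matrix_mul continuous_id).matrix_elem i j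
    · exact continuous_id.matrix_elem i j
  refine (hJ.comp_continuousOn h1).congr fun t _ => ?_
  rw [matZ, Matrix.mul_assoc]
  rfl

end SymplecticFrame

end LagrangianOsc

theorem theoremT (n : ℕ) (a b : ℝ) (hab : a ≤ b)
    (Y Yh : ℝ → LagrangianOsc.Mat21 n)
    (hY : LagrangianOsc.IsLagrangianPath a b Y)
    (hYh : LagrangianOsc.IsLagrangianPath a b Yh) :
    -- the oscillation numbers of the two given paths are well defined
    LagrangianOsc.OscWellDefined a b Y ∧
    LagrangianOsc.OscWellDefined a b Yh ∧
    -- the comparison formulas with `Z_Ŷ`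
    LagrangianOsc.OscWellDefined a b (fun t => (LagrangianOsc.matZ (Yh t))⁻¹ * Y t) ∧
    LagrangianOsc.oscNumber a b Y - LagrangianOsc.oscNumber a b Yh =
      LagrangianOsc.compIndex (Y b) (Yh b) - LagrangianOsc.compIndex (Y a) (Yh a) +
        LagrangianOsc.oscNumber a b (fun t => (LagrangianOsc.matZ (Yh t))⁻¹ * Y t) ∧
    LagrangianOsc.dualOscNumber a b Y - LagrangianOsc.dualOscNumber a b Yh =
      LagrangianOsc.dualCompIndex (Y a) (Yh a) - LagrangianOsc.dualCompIndex (Y b) (Yh b) +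
        LagrangianOsc.dualOscNumber a b (fun t => (LagrangianOsc.matZ (Yh t))⁻¹ * Y t) ∧
    -- the same with an arbitrary continuous symplectic `Ẑ` such that `Ẑ E = Ŷ`
    ∀ Zh : ℝ → LagrangianOsc.Mat2 n, LagrangianOsc.IsSymplecticPath a b Zh →
      (∀ t ∈ Set.Icc a b, Zh t * LagrangianOsc.vertE n = Yh t) →
      LagrangianOsc.OscWellDefined a b (fun t => (Zh t)⁻¹ * Y t) ∧
      LagrangianOsc.oscNumber a b Y - LagrangianOsc.oscNumber a b Yh =
        LagrangianOsc.compIndex (Y b) (Yh b) - LagrangianOsc.compIndex (Y a) (Yh a) +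
          LagrangianOsc.oscNumber a b (fun t => (Zh t)⁻¹ * Y t) ∧
      LagrangianOsc.dualOscNumber a b Y - LagrangianOsc.dualOscNumber a b Yh =
        LagrangianOsc.dualCompIndex (Y a) (Yh a) - LagrangianOsc.dualCompIndex (Y b) (Yh b) +
          LagrangianOsc.dualOscNumber a b (fun t => (Zh t)⁻¹ * Y t) := by
  have h := LagrangianOsc.oscNumber_comparison hab hY hYh
    (LagrangianOsc.isSymplecticPath_matZ hYh)
    (fun t ht => (hYh.2 t ht).isUnit_det_normK)
    (fun t _ => LagrangianOsc.matZ_mul_vertE (Yh t))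
  refine ⟨hY.oscWellDefined hab, hYh.oscWellDefined hab, h.1, h.2.1, h.2.2, fun Zh hZh hE => ?_⟩
  exact LagrangianOsc.oscNumber_comparison hab hY hYh hZh (K := fun _ => 1)
    (fun _ _ => by rw [Matrix.det_one]; exact isUnit_one)
    (fun t ht => by rw [hE t ht, Matrix.mul_one])
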